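/- Let $\mathbf{k}$ be a field, let $R=\mathbf{k}[x_1,\dots,x_n]$ with its standard grading, and let $\mathcal{H}$ be a simple hypergraph on the vertex set $[n]=\{1,\dots,n\}$, i.e. every edge has at least two vertices and no edge is contained in a different edge. Let $$J_{\mathcal{H}}=\Big(\prod_{i\in E}x_i\ ;\ E\text{ an edge of }\mathcal{H}\Big),\qquad I=J_{\mathcal{H}}+(x_1^2,\dots,x_n^2).$$ A set $W\subseteq[n]$ is independent if it contains no edge of $\mathcal{H}$. Let $\Delta(\mathcal{H})$ be the simplicial complex of all independent sets (including $\emptyset$), let $\max(\mathcal{H})$ be the set of maximal independent sets, and let $\alpha(\mathcal{H})$ be the largest size of an independent set. Then $R/I$ has a minimal graded free resolution by finitely generated free modules; for any such resolution $\cdots\to F_1\to F_0\to R/I\to 0$ with $F_i=\bigoplus_{j}R(-j)^{\beta_{i,j}(R/I)}$ and $\beta_i(R/I)=\operatorname{rank}F_i=\sum_j\beta_{i,j}(R/I)$ one has: 1. For every $j\in\mathbb{Z}$, $\ \beta_{n,j}(R/I)=|\{\sigma\in\max(\mathcal{H})\ ;\ |\sigma|=j-n\}|$. 2. $\beta_n(R/I)$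 is the number of maximal independent sets of $\mathcal{H}$, and it is the number of facets of $\Delta(\mathcal{H})$. 3. The following are equivalent: (a) $R/I$ is a level ring, i.e. it is Cohen–Macaulay and the last nonzero module of its minimal graded free resolution is generated in a single degree; (b) $\Delta(\mathcal{H})$ is pure, i.e. all its facets have the same size; (c) $J_{\mathcal{H}}$ is unmixed, i.e. all associated primes of $R/J_{\mathcal{H}}$ have the same height. 4. $\operatorname{reg}(R/I)=\max\{j-i\ ;\ \beta_{i,j}(R/I)\neq 0\}=\alpha(\mathcal{H})$. -/

import Mathlib

noncomputable section

/-! ### Hypergraphs and independent sets -/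

namespace Hypergraph

variable {V : Type*}

/-- A simple hypergraph: every edge has at least two vertices, and no edge is contained in another
edge. -/
def IsSimple (H : Hypergraph V) : Prop :=
  (∀ e ∈ H.edgeSet, 2 ≤ e.encard) ∧ ∀ e ∈ H.edgeSet, ∀ f ∈ H.edgeSet, e ⊆ f → e = f

/-- An independent set: a (finite) set of vertices which does not contain an edge. -/
def IsIndependent (H : Hypergraph V) (W : Finset V) : Prop :=
  (W : Set V) ⊆ H.vertexSet ∧ ∀ e ∈ H.edgeSet, ¬ e ⊆ (W : Set V)

open Classical in
/-- The maximal independent sets: independent sets such that adding any other vertex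
forces the set to contain an edge. (If there are no edges, the only one is the set of
all vertices.) -/
def maximalIndependentSets (H : Hypergraph V) : Set (Finset V) :=
  {W | H.IsIndependent W ∧
    ∀ v ∈ H.vertexSet, v ∉ W → ∃ e ∈ H.edgeSet, e ⊆ ((insert v W : Finset V) : Set V)}

/-- The independence complex of `H`: the family of independent sets, which is closed under passing
to subsets. As usual in combinatorial commutative algebra, the empty set is a face. -/
def independenceComplex (H : Hypergraph V) : LowerSet (Finset V) where
  carrier := {W | H.IsIndependent W}
  lower' := fun _ _ hle hW =>
    ⟨(Finset.coe_subset.mpr hle).trans hW.1,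
      fun e he hsub => hW.2 e he (hsub.trans (Finset.coe_subset.mpr hle))⟩

open Classical in
/-- The independence number: the largest size of an independent set. -/
def independenceNumber [Fintype V] (H : Hypergraph V) : ℕ :=
  (Finset.univ.filter fun W : Finset V => H.IsIndependent W).sup Finset.card

end Hypergraph

namespace SimplicialFamily

variable {V : Type*}

/-- The facets of a simplicial complex (a family of finite sets closed under passing to subsets):
the faces that are maximal with respect to inclusion. -/
def facets (Δ : LowerSet (Finset V)) : Set (Finset V) :=
  {F | Maximal (fun G => G ∈ Δ) F}

/-- A simplicial complex is pure if all its facets have the same cardinality. -/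
def IsPure (Δ : LowerSet (Finset V)) : Prop :=
  ∀ F ∈ facets Δ, ∀ G ∈ facets Δ, F.card = G.card

end SimplicialFamily

/-! ### Graded free resolutions over a polynomial ring -/

namespace GradedRes

variable {k : Type*} [Field k] {n : ℕ}

variable (k n) in
/-- The graded maximal ideal `(x₁, …, xₙ)`. -/
def maxIdeal : Ideal (MvPolynomial (Fin n) k) :=
  Ideal.span (Set.range MvPolynomial.X)

variable (k n) in
/-- The homogeneous polynomials of degree `d ∈ ℤ` (only zero if `d < 0`). -/
def polyPiece (d : ℤ) : Submodule k (MvPolynomial (Fin n) k) :=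
  if 0 ≤ d then MvPolynomial.homogeneousSubmodule (Fin n) k d.toNat else ⊥

/-- The degree `d` part of `R ⧸ I`. -/
def quotPiece (I : Ideal (MvPolynomial (Fin n) k)) (d : ℤ) :
    Submodule k (MvPolynomial (Fin n) k ⧸ I) :=
  (polyPiece k n d).map (Ideal.Quotient.mkₐ k I).toLinearMap

/-- The degree `d` part of the graded free module `⨁ₐ R(-deg a)`, whose `a`-th basis vector has
degree `deg a`. -/
def freePiece {r : ℕ} (deg : Fin r → ℤ) (d : ℤ) :
    Submodule k (Fin r → MvPolynomial (Fin n) k) :=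
  Submodule.pi Set.univ fun a => polyPiece k n (d - deg a)

/-- A minimal graded free resolution
`⋯ → F₂ → F₁ → F₀ → M → 0` of a module `M` over `R = k[x₁, …, xₙ]` whose degree `j` part is `𝓜 j`,
by finitely generated graded free modules `Fᵢ = ⨁ₐ R(-deg i a)`. -/
structure MinimalResolution {M : Type*} [AddCommGroup M] [Module k M]
    [Module (MvPolynomial (Fin n) k) M] (𝓜 : ℤ → Submodule k M) where
  /-- the rank of `Fᵢ` -/
  rank : ℕ → ℕ
  /-- the degrees of the basis vectors of `Fᵢ` -/
  deg : ∀ i, Fin (rank i) → ℤ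
  /-- the differential `Fᵢ₊₁ → Fᵢ` -/
  d : ∀ i, (Fin (rank (i + 1)) → MvPolynomial (Fin n) k) →ₗ[MvPolynomial (Fin n) k]
    (Fin (rank i) → MvPolynomial (Fin n) k)
  /-- the augmentation `F₀ → M` -/
  aug : (Fin (rank 0) → MvPolynomial (Fin n) k) →ₗ[MvPolynomial (Fin n) k] M
  d_mem : ∀ i j, ∀ v ∈ freePiece (k := k) (n := n) (deg (i + 1)) j, d i v ∈ freePiece (deg i) j
  aug_mem : ∀ j, ∀ v ∈ freePiece (k := k) (n := n) (deg 0) j, aug v ∈ 𝓜 j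
  exact_d : ∀ i, Function.Exact (d (i + 1)) (d i)
  exact_aug : Function.Exact (d 0) aug
  aug_surjective : Function.Surjective aug
  /-- minimality: the image of `Fᵢ₊₁ → Fᵢ` lies in `(x₁, …, xₙ) Fᵢ` -/
  minimal : ∀ i v a, d i v a ∈ maxIdeal k n

namespace MinimalResolution

variable {M : Type*} [AddCommGroup M] [Module k M] [Module (MvPolynomial (Fin n) k) M]
  {𝓜 : ℤ → Submodule k M}

/-- The graded Betti number `β_{i,j}`: the number of copies of `R(-j)` in `Fᵢ`. -/
def betti (F : MinimalResolution (n := n) 𝓜) (i : ℕ) (j : ℤ) : ℕ :=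
  (Finset.univ.filter fun a => F.deg i a = j).card

/-- The (total) Betti number `β_i`, the rank of `Fᵢ`. -/
def totalBetti (F : MinimalResolution (n := n) 𝓜) (i : ℕ) : ℕ :=
  F.rank i

/-- `r` is the Castelnuovo-Mumford regularity, `max {j - i | β_{i,j} ≠ 0}`. The maximum is required
to exist. -/
def HasRegularity (F : MinimalResolution (n := n) 𝓜) (r : ℤ) : Prop :=
  IsGreatest {m : ℤ | ∃ (i : ℕ) (j : ℤ), F.betti i j ≠ 0 ∧ m = j - i} r

/-- The last nonzero module of the resolution exists and is of the form `R(-s)^a`. -/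
def LastInSingleDegree (F : MinimalResolution (n := n) 𝓜) : Prop :=
  ∃ p : ℕ, F.rank p ≠ 0 ∧ (∀ q, p < q → F.rank q = 0) ∧ ∃ s : ℤ, ∀ a, F.deg p a = s

end MinimalResolution

/-- The graded ring `R ⧸ I` is Cohen-Macaulay: `(x₁, …, xₙ)` contains a regular sequence on `R ⧸ I`
whose length is the Krull dimension of `R ⧸ I`. -/
def IsCohenMacaulay (I : Ideal (MvPolynomial (Fin n) k)) : Prop :=
  ∃ rs : List (MvPolynomial (Fin n) k), (∀ f ∈ rs, f ∈ maxIdeal k n) ∧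
    RingTheory.Sequence.IsRegular (MvPolynomial (Fin n) k ⧸ I) rs ∧
    (rs.length : WithBot ℕ∞) = ringKrullDim (MvPolynomial (Fin n) k ⧸ I)

/-- The graded ring `R ⧸ I` is level: it is Cohen-Macaulay and the last nonzero module of its
minimal graded free resolution is generated in a single degree. -/
def IsLevel (I : Ideal (MvPolynomial (Fin n) k)) : Prop :=
  IsCohenMacaulay I ∧ ∃ F : MinimalResolution (n := n) (quotPiece I), F.LastInSingleDegree

/-- An ideal is unmixed if all its associated primes (those of `R ⧸ J`) have the same height. -/
def IsUnmixed {R : Type*} [CommRing R] (J : Ideal R) : Prop :=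
  ∀ P ∈ associatedPrimes R (R ⧸ J), ∀ Q ∈ associatedPrimes R (R ⧸ J), P.height = Q.height

variable (k) in
/-- The edge ideal of a hypergraph on the vertices `1, …, n`, generated by the squarefree monomials
`∏_{x ∈ E} x` for the edges `E`. -/
def edgeIdeal (H : Hypergraph (Fin n)) : Ideal (MvPolynomial (Fin n) k) :=
  Ideal.span {f | ∃ E : Finset (Fin n), (E : Set (Fin n)) ∈ H.edgeSet ∧
    f = ∏ x ∈ E, MvPolynomial.X x}

variable (k) in
/-- The ideal `J_H + (x₁², …, xₙ²)`. -/
def edgeIdealPlusSquares (H : Hypergraph (Fin n)) : Ideal (MvPolynomial (Fin n) k) :=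
  edgeIdeal k H ⊔ Ideal.span (Set.range fun i : Fin n => MvPolynomial.X i ^ 2)

end GradedRes

end

/-! The Betti number β_{p,j}(R/I) is the dimension of the degree j part of the Koszul homology
H_p(x₁, …, xₙ; R/I). This is obtained without Tor, by dimension shifting along the resolution
(`MinimalResolution.betti_eq_koszulHomDim`): the Koszul complex of a free module is acyclic in
positive homological degrees (`koszul_free_acyclic`), so H_{p+1} of a module is H_p of its first
syzygy module (`koszulHomDim_succ`), while H_0 counts minimal generators (`koszulHomDim_zero`).

For p = n there are no boundaries, and the cycles form the socle of R/I, shifted by n. The monomials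
x_W with W independent are a basis of R/I, and the socle is spanned by those with W maximal: x_i x_W
is divisible by a square if i ∈ W, and by an edge monomial otherwise. This yields β_{n,j} and the
total β_n (`koszulHomDim_socle`).

For the regularity, H_i in degree j is a subquotient of copies of (R/I)_{j-i}, which is nonzero only
if some independent set has size j - i; a largest independent set attains the bound at i = n. For
levelness, R/I is finite-dimensional, hence Cohen–Macaulay, and Fₙ is the last nonzero module, with
generators in the degrees |W| + n. Finally, the associated primes of J_H are the ideals generated by
the variables outside a maximal independent W, of height n - |W|, so unmixedness is purity. -/

noncomputable section

namespace GradedRes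

open MvPolynomial

variable {k : Type*} [Field k] {n : ℕ}

/-! ### Homogeneous components -/

theorem mem_polyPiece {d : ℤ} {f : MvPolynomial (Fin n) k} :
    f ∈ polyPiece k n d ↔ ∀ m, f.coeff m ≠ 0 → (m.degree : ℤ) = d := by
  unfold polyPiece
  split_ifs with h
  · rw [mem_homogeneousSubmodule]
    constructor
    · intro hf m hm
      have := hf.coeff_eq_zero (d := m)
      by_contra hne
      exact hm (this (by omega))
    · intro hf m hm
      change Finsupp.weight (fun _ => 1) m = _
      rw [← Finsupp.degree_eq_weight_one]
      have := hf m hm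
      omega
  · rw [Submodule.mem_bot]
    constructor
    · rintro rfl m hm
      simp at hm
    · intro hf
      ext m
      by_contra hm
      have := hf m (by simpa using hm)
      omega

variable (k n) in
/-- The projection of a polynomial onto its homogeneous component of degree `d ∈ ℤ`. -/
def polyComp (d : ℤ) : MvPolynomial (Fin n) k →ₗ[k] MvPolynomial (Fin n) k :=
  if 0 ≤ d then homogeneousComponent d.toNat else 0

theorem coeff_polyComp (d : ℤ) (f : MvPolynomial (Fin n) k) (m : Fin n →₀ ℕ) :
    (polyComp k n d f).coeff m = if (m.degree : ℤ) = d then f.coeff m else 0 := by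
  unfold polyComp
  split_ifs with h h' h'
  · rw [coeff_homogeneousComponent, if_pos (by omega)]
  · rw [coeff_homogeneousComponent, if_neg (by omega)]
  · omega
  · simp

theorem polyComp_mem (d : ℤ) (f : MvPolynomial (Fin n) k) : polyComp k n d f ∈ polyPiece k n d := by
  rw [mem_polyPiece]
  intro m hm
  rw [coeff_polyComp] at hm
  by_contra h
  exact hm (if_neg h)

theorem polyComp_of_mem {d : ℤ} {f : MvPolynomial (Fin n) k} (hf : f ∈ polyPiece k n d) :
    polyComp k n d f = f := by
  ext m
  rw [coeff_polyComp]
  split_ifs with h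
  · rfl
  · by_contra hm
    exact h (mem_polyPiece.1 hf m (Ne.symm hm))

theorem polyComp_of_mem_ne {d e : ℤ} (hde : d ≠ e) {f : MvPolynomial (Fin n) k}
    (hf : f ∈ polyPiece k n e) : polyComp k n d f = 0 := by
  ext m
  rw [coeff_polyComp, coeff_zero]
  split_ifs with h
  · by_contra hm
    exact hde (h.symm.trans (mem_polyPiece.1 hf m hm))
  · rfl

theorem monomial_mem_polyPiece (m : Fin n →₀ ℕ) (c : k) :
    monomial m c ∈ polyPiece k n m.degree := by
  rw [mem_polyPiece]
  intro m' hm'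
  rw [coeff_monomial] at hm'
  split_ifs at hm' with h
  · rw [h]
  · exact absurd rfl hm'

theorem X_mul_mem_polyPiece {d : ℤ} {f : MvPolynomial (Fin n) k} (hf : f ∈ polyPiece k n d)
    (i : Fin n) : X i * f ∈ polyPiece k n (d + 1) := by
  rw [mem_polyPiece] at *
  intro m hm
  rw [coeff_X_mul'] at hm
  split_ifs at hm with h
  · have := hf _ hm
    have hle : Finsupp.single i 1 ≤ m := by
      simpa [Nat.one_le_iff_ne_zero] using h
    have h2 := congrArg Finsupp.degree (tsub_add_cancel_of_le hle)
    rw [map_add, Finsupp.degree_single] at h2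
    omega
  · exact absurd rfl hm

theorem polyComp_X_mul (d : ℤ) (i : Fin n) (f : MvPolynomial (Fin n) k) :
    polyComp k n (d + 1) (X i * f) = X i * polyComp k n d f := by
  ext m
  rw [coeff_polyComp, coeff_X_mul', coeff_X_mul', coeff_polyComp]
  by_cases h : i ∈ m.support
  · have hle : Finsupp.single i 1 ≤ m := by
      simpa [Nat.one_le_iff_ne_zero] using h
    have h2 := congrArg Finsupp.degree (tsub_add_cancel_of_le hle)
    rw [map_add, Finsupp.degree_single] at h2
    rw [if_pos h, if_pos h]
    congr 1
    apply propext
    omega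
  · simp [h]

theorem divMonomial_mem_polyPiece {d : ℤ} {f : MvPolynomial (Fin n) k}
    (hf : f ∈ polyPiece k n (d + 1)) (i : Fin n) :
    f.divMonomial (Finsupp.single i 1) ∈ polyPiece k n d := by
  rw [mem_polyPiece] at *
  intro m hm
  rw [coeff_divMonomial] at hm
  have := hf _ hm
  rw [map_add, Finsupp.degree_single] at this
  omega

theorem mem_maxIdeal {f : MvPolynomial (Fin n) k} : f ∈ maxIdeal k n ↔ f.coeff 0 = 0 := by
  have := mem_ideal_span_X_image (R := k) (x := f) (s := (Set.univ : Set (Fin n)))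
  rw [Set.image_univ] at this
  rw [maxIdeal, this]
  constructor
  · intro h
    by_contra h0
    obtain ⟨i, -, hi⟩ := h 0 (mem_support_iff.2 h0)
    exact hi rfl
  · intro h m hm
    by_contra! hc
    have : m = 0 := Finsupp.ext fun i => hc i trivial
    exact mem_support_iff.1 hm (this ▸ h)

/-- In any expression of f through the variables, the coefficients can be replaced by their
components of degree d - 1, because f is homogeneous. -/
theorem exists_eq_sum_X_mul {d : ℤ} {f : MvPolynomial (Fin n) k} (hf : f ∈ polyPiece k n d)
    (h : f ∈ maxIdeal k n) :
    ∃ g : Fin n → MvPolynomial (Fin n) k, (∀ i, g i ∈ polyPiece k n (d - 1)) ∧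
      f = ∑ i, X i * g i := by
  obtain ⟨c, hc⟩ := Ideal.mem_span_range_iff_exists_fun.1 h
  refine ⟨fun i => polyComp k n (d - 1) (c i), fun i => polyComp_mem _ _, ?_⟩
  rw [← polyComp_of_mem hf, ← hc, map_sum]
  refine Finset.sum_congr rfl fun i _ => ?_
  rw [mul_comm, ← polyComp_X_mul, sub_add_cancel]

/-! ### Graded free modules -/

theorem mem_freePiece {r : ℕ} {deg : Fin r → ℤ} {d : ℤ} {v : Fin r → MvPolynomial (Fin n) k} :
    v ∈ freePiece deg d ↔ ∀ a, v a ∈ polyPiece k n (d - deg a) := by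
  simp [freePiece, Submodule.mem_pi]

/-- The projection of a graded free module onto its degree `j` part. -/
def freeComp {r : ℕ} (deg : Fin r → ℤ) (j : ℤ) :
    (Fin r → MvPolynomial (Fin n) k) →ₗ[k] (Fin r → MvPolynomial (Fin n) k) :=
  LinearMap.pi fun a => polyComp k n (j - deg a) ∘ₗ LinearMap.proj a

@[simp] theorem freeComp_apply {r : ℕ} (deg : Fin r → ℤ) (j : ℤ)
    (v : Fin r → MvPolynomial (Fin n) k) (a : Fin r) :
    freeComp deg j v a = polyComp k n (j - deg a) (v a) := rfl

theorem freeComp_mem {r : ℕ} (deg : Fin r → ℤ) (j : ℤ) (v : Fin r → MvPolynomial (Fin n) k) :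
    freeComp deg j v ∈ freePiece deg j :=
  mem_freePiece.2 fun _ => polyComp_mem _ _

theorem freeComp_of_mem {r : ℕ} {deg : Fin r → ℤ} {j : ℤ} {v : Fin r → MvPolynomial (Fin n) k}
    (hv : v ∈ freePiece deg j) : freeComp deg j v = v :=
  funext fun a => polyComp_of_mem (mem_freePiece.1 hv a)

theorem freeComp_of_mem_ne {r : ℕ} {deg : Fin r → ℤ} {j j' : ℤ} (h : j ≠ j')
    {v : Fin r → MvPolynomial (Fin n) k} (hv : v ∈ freePiece deg j') : freeComp deg j v = 0 :=
  funext fun a => polyComp_of_mem_ne (by omega) (mem_freePiece.1 hv a)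

theorem iSup_freePiece {r : ℕ} (deg : Fin r → ℤ) :
    ⨆ j, freePiece (k := k) (n := n) deg j = ⊤ := by
  rw [eq_top_iff]
  rintro v -
  have hv : v = ∑ a, ∑ m ∈ (v a).support, Pi.single a (monomial m ((v a).coeff m)) := by
    conv_lhs => rw [← Finset.univ_sum_single v]
    refine Finset.sum_congr rfl fun a _ => ?_
    conv_lhs => rw [(v a).as_sum]
    exact map_sum (AddMonoidHom.single _ a) _ _
  rw [hv]
  refine Submodule.sum_mem _ fun a _ => Submodule.sum_mem _ fun m _ => ?_
  refine Submodule.mem_iSup_of_mem ((m.degree : ℤ) + deg a) (mem_freePiece.2 fun b => ?_)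
  by_cases h : b = a
  · subst h
    rw [Pi.single_eq_same, add_sub_cancel_right]
    exact monomial_mem_polyPiece _ _
  · rw [Pi.single_eq_of_ne h]
    exact Submodule.zero_mem _

/-- Replaces a direct sum decomposition: additive statements need only be checked on homogeneous
vectors. -/
theorem freePiece_induction {r : ℕ} (deg : Fin r → ℤ)
    {p : (Fin r → MvPolynomial (Fin n) k) → Prop}
    (mem : ∀ j, ∀ v ∈ freePiece deg j, p v) (zero : p 0) (add : ∀ v w, p v → p w → p (v + w))
    (v : Fin r → MvPolynomial (Fin n) k) : p v :=
  Submodule.iSup_induction (fun j => freePiece (k := k) (n := n) deg j) (motive := p)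
    (by rw [iSup_freePiece]; trivial) mem zero add

/-- This is what allows preimages of homogeneous elements under graded maps to be chosen
homogeneous. -/
theorem map_freeComp {r s : ℕ} {deg : Fin r → ℤ} {deg' : Fin s → ℤ}
    (φ : (Fin r → MvPolynomial (Fin n) k) →ₗ[MvPolynomial (Fin n) k]
      (Fin s → MvPolynomial (Fin n) k))
    (hφ : ∀ j, ∀ v ∈ freePiece deg j, φ v ∈ freePiece deg' j) (j : ℤ)
    (v : Fin r → MvPolynomial (Fin n) k) : φ (freeComp deg j v) = freeComp deg' j (φ v) := by
  induction v using freePiece_induction deg with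
  | mem j' v hv =>
    by_cases h : j = j'
    · subst h
      rw [freeComp_of_mem hv, freeComp_of_mem (hφ _ _ hv)]
    · rw [freeComp_of_mem_ne h hv, freeComp_of_mem_ne h (hφ _ _ hv), map_zero]
  | zero => simp
  | add v w hv hw => rw [map_add, map_add, map_add, map_add, hv, hw]

theorem X_smul_mem_freePiece {r : ℕ} {deg : Fin r → ℤ} {j : ℤ}
    {v : Fin r → MvPolynomial (Fin n) k} (hv : v ∈ freePiece deg j) (i : Fin n) :
    (X i : MvPolynomial (Fin n) k) • v ∈ freePiece deg (j + 1) := by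
  rw [mem_freePiece] at *
  intro a
  have := X_mul_mem_polyPiece (hv a) i
  rwa [sub_add_eq_add_sub] at this

/-! ### The Koszul complex -/

/-- The sign with which `i` enters the set `S` in the Koszul differential. -/
def koszulSign (i : Fin n) (S : Finset (Fin n)) : ℤ := (-1) ^ (S.filter (· < i)).card

theorem koszulSign_mul_self (i : Fin n) (S : Finset (Fin n)) :
    koszulSign i S * koszulSign i S = 1 := by
  rw [koszulSign, ← mul_pow]
  simp

theorem koszulSign_insert {i l : Fin n} {S : Finset (Fin n)} (hl : l ∉ S) :
    koszulSign i (insert l S) = if l < i then -koszulSign i S else koszulSign i S := by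
  unfold koszulSign
  rw [Finset.filter_insert]
  split_ifs
  · rw [Finset.card_insert_of_notMem (by simp [hl]), pow_succ, mul_neg_one]
  · rfl

section Piece

variable {N : Type*} [AddCommGroup N] [Module k N]

/-- The degree `j` part of the `p`-th module of the Koszul complex of a graded module. -/
def koszulPiece (𝓝 : ℤ → Submodule k N) (p : ℕ) (j : ℤ) : Submodule k (Finset (Fin n) → N) :=
  Submodule.pi Set.univ fun S => if S.card = p then 𝓝 (j - p) else ⊥

theorem mem_koszulPiece {𝓝 : ℤ → Submodule k N} {p : ℕ} {j : ℤ} {f : Finset (Fin n) → N} :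
    f ∈ koszulPiece 𝓝 p j ↔
      (∀ S, S.card = p → f S ∈ 𝓝 (j - p)) ∧ ∀ S, S.card ≠ p → f S = 0 := by
  simp only [koszulPiece, Submodule.mem_pi, Set.mem_univ, true_imp_iff]
  constructor
  · refine fun h => ⟨fun S hS => ?_, fun S hS => ?_⟩
    · simpa [hS] using h S
    · simpa [hS] using h S
  · intro h S
    split_ifs with hS
    · exact h.1 S hS
    · exact h.2 S hS

/-- The homotopy on the Koszul complex given by "division by `xᵢ`" on the coefficients. -/
def koszulHomotopy (i : Fin n) (D : N →+ N) (f : Finset (Fin n) → N) : Finset (Fin n) → N :=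
  fun T => if i ∈ T then koszulSign i T • D (f (T.erase i)) else 0

theorem koszulHomotopy_mem {i : Fin n} {D : N →+ N} {𝓝 : ℤ → Submodule k N}
    (hD : ∀ d, ∀ v ∈ 𝓝 (d + 1), D v ∈ 𝓝 d) {p : ℕ} {j : ℤ}
    {f : Finset (Fin n) → N} (hf : f ∈ koszulPiece 𝓝 p j) :
    koszulHomotopy i D f ∈ koszulPiece 𝓝 (p + 1) j := by
  rw [mem_koszulPiece] at *
  refine ⟨fun S hS => ?_, fun S hS => ?_⟩
  · rw [koszulHomotopy]
    split_ifs with hi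
    · refine zsmul_mem (hD _ _ ?_) _
      have := hf.1 (S.erase i) (by rw [Finset.card_erase_of_mem hi, hS]; rfl)
      convert this using 2
      push_cast
      ring
    · exact zero_mem _
  · rw [koszulHomotopy]
    split_ifs with hi
    · rw [hf.2 (S.erase i) (by
        have := Finset.card_erase_add_one hi
        omega), map_zero, smul_zero]
    · rfl

end Piece

section Diff

variable {N N' : Type*} [AddCommGroup N] [Module k N] [Module (MvPolynomial (Fin n) k) N]
  [IsScalarTower k (MvPolynomial (Fin n) k) N]
  [AddCommGroup N'] [Module k N'] [Module (MvPolynomial (Fin n) k) N']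
  [IsScalarTower k (MvPolynomial (Fin n) k) N']

variable (k N) in
/-- The differential of the Koszul complex of `x₁, …, xₙ` with coefficients in `N`. The basis vector
indexed by `{i₁ < ⋯ < iₚ}` is `e_{i₁} ∧ ⋯ ∧ e_{iₚ}`. -/
def koszulDiff : (Finset (Fin n) → N) →ₗ[k] (Finset (Fin n) → N) where
  toFun f S := ∑ i ∈ Sᶜ, koszulSign i S • (X i : MvPolynomial (Fin n) k) • f (insert i S)
  map_add' f g := by
    ext S
    simp [Finset.sum_add_distrib]
  map_smul' c f := by
    ext S
    have : SMulCommClass (MvPolynomial (Fin n) k) k N := IsScalarTower.to_smulCommClass'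
    simp only [Pi.smul_apply, RingHom.id_apply, Finset.smul_sum]
    refine Finset.sum_congr rfl fun i _ => ?_
    rw [smul_comm (X i) c, smul_comm _ c]

theorem koszulDiff_apply (f : Finset (Fin n) → N) (S : Finset (Fin n)) :
    koszulDiff k N f S =
      ∑ i ∈ Sᶜ, koszulSign i S • (X i : MvPolynomial (Fin n) k) • f (insert i S) := rfl

/-- The terms removing i then l and l then i cancel: they have the same coefficient X i * X l, and
`koszulSign_insert` gives them opposite signs. -/
theorem koszulDiff_koszulDiff (f : Finset (Fin n) → N) : koszulDiff k N (koszulDiff k N f) = 0 := by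
  ext S
  simp only [koszulDiff_apply, Finset.smul_sum, Pi.zero_apply]
  rw [Finset.sum_sigma']
  refine Finset.sum_involution (fun x _ => ⟨x.2, x.1⟩) ?_ ?_ ?_ ?_
  · rintro ⟨i, l⟩ h
    simp only [Finset.mem_sigma, Finset.mem_compl, Finset.mem_insert, not_or] at h
    obtain ⟨hi, hli, hl⟩ := h
    simp only
    have aux : ∀ (a b : ℤ) (x y : MvPolynomial (Fin n) k) (v : N),
        a • x • b • y • v = (a * b) • (x * y) • v := by
      intro a b x y v
      rw [smul_comm x b, smul_smul, smul_smul]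
    rw [Finset.insert_comm i l, aux, aux, mul_comm (X l : MvPolynomial (Fin n) k), ← add_smul,
      koszulSign_insert hi, koszulSign_insert hl]
    rcases lt_or_gt_of_ne hli with h | h
    · rw [if_neg h.not_gt, if_pos h]
      convert zero_smul ℤ _ using 2
      ring
    · rw [if_pos h, if_neg h.not_gt]
      convert zero_smul ℤ _ using 2
      ring
  · rintro ⟨i, l⟩ h - heq
    simp only [Finset.mem_sigma, Finset.mem_compl, Finset.mem_insert, not_or] at h
    simp only [Sigma.mk.injEq] at heq
    exact h.2.1 heq.1
  · rintro ⟨i, l⟩ h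
    simp only [Finset.mem_sigma, Finset.mem_compl, Finset.mem_insert, not_or] at h ⊢
    exact ⟨h.2.2, fun e => h.2.1 e.symm, h.1⟩
  · rintro ⟨i, l⟩ h
    rfl

theorem koszulDiff_comp (g : N →ₗ[MvPolynomial (Fin n) k] N') (f : Finset (Fin n) → N) :
    koszulDiff k N' (fun S => g (f S)) = fun S => g (koszulDiff k N f S) := by
  ext S
  simp only [koszulDiff_apply, map_sum, map_zsmul, map_smul]

theorem koszulDiff_mem {𝓝 : ℤ → Submodule k N}
    (h𝓝 : ∀ d, ∀ v ∈ 𝓝 d, ∀ i, (X i : MvPolynomial (Fin n) k) • v ∈ 𝓝 (d + 1)) {p : ℕ} {j : ℤ}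
    {f : Finset (Fin n) → N} (hf : f ∈ koszulPiece 𝓝 (p + 1) j) :
    koszulDiff k N f ∈ koszulPiece 𝓝 p j := by
  rw [mem_koszulPiece] at *
  refine ⟨fun S hS => ?_, fun S hS => ?_⟩
  · rw [koszulDiff_apply]
    refine Submodule.sum_mem _ fun i hi => zsmul_mem ?_ _
    have := h𝓝 _ _ (hf.1 (insert i S)
      (by rw [Finset.card_insert_of_notMem (Finset.mem_compl.1 hi), hS])) i
    convert this using 2
    push_cast
    ring
  · rw [koszulDiff_apply]
    refine Finset.sum_eq_zero fun i hi => ?_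
    rw [hf.2 (insert i S)
      (by rw [Finset.card_insert_of_notMem (Finset.mem_compl.1 hi)]; omega), smul_zero, smul_zero]

end Diff

/-! ### Acyclicity of the Koszul complex of a free module -/

section Homotopy

variable {N : Type*} [AddCommGroup N] [Module k N] [Module (MvPolynomial (Fin n) k) N]
  [IsScalarTower k (MvPolynomial (Fin n) k) N]

/-- Write S = T ∪ {i}. Applying D to the cycle condition at T solves for f S in terms of the f (T ∪
{l}) with l ≠ i, and up to sign this sum is the differential of the homotopy. Only S containing i
are covered: D is just a left inverse of multiplication by xᵢ. -/
theorem koszulDiff_koszulHomotopy {i : Fin n} {D : N →+ N}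
    (hD : ∀ v, D ((X i : MvPolynomial (Fin n) k) • v) = v)
    (hD' : ∀ l ≠ i, ∀ v, D ((X l : MvPolynomial (Fin n) k) • v) =
      (X l : MvPolynomial (Fin n) k) • D v)
    {f : Finset (Fin n) → N} (hf : koszulDiff k N f = 0) {S : Finset (Fin n)} (hi : i ∈ S) :
    koszulDiff k N (koszulHomotopy i D f) S = f S := by
  obtain ⟨T, hiT, rfl⟩ : ∃ T, i ∉ T ∧ insert i T = S :=
    ⟨S.erase i, Finset.notMem_erase i S, Finset.insert_erase hi⟩
  have hc : Tᶜ = insert i (insert i T)ᶜ := by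
    ext l
    by_cases h : l = i <;> simp [h, hiT]
  have h0 := congrArg D (congrFun hf T)
  rw [koszulDiff_apply, hc, Finset.sum_insert (by simp), map_add, map_zsmul, hD, Pi.zero_apply,
    map_zero, map_sum] at h0
  have h1 : koszulDiff k N (koszulHomotopy i D f) (insert i T) =
      -(koszulSign i T • ∑ l ∈ (insert i T)ᶜ,
        D (koszulSign l T • (X l : MvPolynomial (Fin n) k) • f (insert l T))) := by
    rw [koszulDiff_apply, Finset.smul_sum, ← Finset.sum_neg_distrib]
    refine Finset.sum_congr rfl fun l hl => ?_
    have hl' := Finset.mem_compl.1 hl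
    have hli : l ≠ i := fun e => hl' (e ▸ Finset.mem_insert_self _ _)
    have hlT : l ∉ T := fun e => hl' (Finset.mem_insert_of_mem e)
    have he : (insert l (insert i T)).erase i = insert l T := by
      rw [Finset.insert_comm, Finset.erase_insert]
      simp [hiT, hli.symm]
    rw [koszulHomotopy, if_pos (by simp), he, map_zsmul, hD' l hli,
      smul_comm (X l : MvPolynomial (Fin n) k), smul_smul, smul_smul, ← neg_smul,
      koszulSign_insert hl', koszulSign_insert hiT, koszulSign_insert hiT, if_neg (lt_irrefl i)]
    congr 1
    rcases lt_or_gt_of_ne hli with h | h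
    · rw [if_neg h.not_gt, if_pos h]
      ring
    · rw [if_pos h, if_neg h.not_gt]
      ring
  rw [h1, ← neg_eq_of_add_eq_zero_right h0, smul_neg, neg_neg, smul_smul, koszulSign_mul_self,
    one_smul]

/-- Correcting a cycle with respect to xᵢ does not spoil the vanishing already achieved on the sets
containing l. -/
theorem koszulDiff_koszulHomotopy_eq_zero {i l : Fin n} (hli : l ≠ i) (D : N →+ N)
    {f : Finset (Fin n) → N} (hf : ∀ S, l ∈ S → f S = 0) {S : Finset (Fin n)} (hl : l ∈ S) :
    koszulDiff k N (koszulHomotopy i D f) S = 0 := by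
  rw [koszulDiff_apply]
  refine Finset.sum_eq_zero fun m _ => ?_
  rw [koszulHomotopy]
  split_ifs
  · rw [hf _ (Finset.mem_erase.2 ⟨hli, Finset.mem_insert_of_mem hl⟩), map_zero, smul_zero,
      smul_zero, smul_zero]
  · rw [smul_zero, smul_zero]

/-- If the coefficients of `N` can be divided by the variables, then the Koszul complex of `N` is
acyclic in positive degrees. -/
theorem koszul_acyclic (D : Fin n → N →+ N)
    (hD : ∀ i v, D i ((X i : MvPolynomial (Fin n) k) • v) = v)
    (hD' : ∀ i, ∀ l ≠ i, ∀ v, D i ((X l : MvPolynomial (Fin n) k) • v) =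
      (X l : MvPolynomial (Fin n) k) • D i v) {𝓝 : ℤ → Submodule k N}
    (hX : ∀ d, ∀ v ∈ 𝓝 d, ∀ i, (X i : MvPolynomial (Fin n) k) • v ∈ 𝓝 (d + 1))
    (hDm : ∀ i d, ∀ v ∈ 𝓝 (d + 1), D i v ∈ 𝓝 d) {p : ℕ} {j : ℤ}
    {f : Finset (Fin n) → N} (hf : f ∈ koszulPiece 𝓝 (p + 1) j) (h0 : koszulDiff k N f = 0) :
    ∃ g ∈ koszulPiece 𝓝 (p + 1 + 1) j, koszulDiff k N g = f := by
  -- The variables are treated one at a time: modulo boundaries, f is made to vanish on every set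
  -- meeting T. For T = univ only the empty set is left, and it carries no coefficient in
  -- homological degree p + 1.
  suffices H : ∀ T : Finset (Fin n), ∃ g ∈ koszulPiece 𝓝 (p + 1 + 1) j,
      ∀ l ∈ T, ∀ S : Finset (Fin n), l ∈ S →
        (f - koszulDiff k N g : Finset (Fin n) → N) S = 0 by
    obtain ⟨g, hg, hgf⟩ := H Finset.univ
    refine ⟨g, hg, ?_⟩
    ext S
    by_cases hS : S.card = p + 1
    · obtain ⟨l, hl⟩ : S.Nonempty := Finset.card_pos.1 (by omega)
      exact (sub_eq_zero.1 (hgf l (Finset.mem_univ l) S hl)).symm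
    · rw [(mem_koszulPiece.1 hf).2 S hS, (mem_koszulPiece.1 (koszulDiff_mem hX hg)).2 S hS]
  intro T
  induction T using Finset.induction_on with
  | empty => exact ⟨0, zero_mem _, by simp⟩
  | insert i T hi ih =>
    obtain ⟨g, hg, hgf⟩ := ih
    set f' := f - koszulDiff k N g with hf'
    have hf'm : f' ∈ koszulPiece 𝓝 (p + 1) j := sub_mem hf (koszulDiff_mem hX hg)
    have hf'0 : koszulDiff k N f' = 0 := by
      rw [hf', map_sub, h0, koszulDiff_koszulDiff, sub_zero]
    refine ⟨g + koszulHomotopy i (D i) f', add_mem hg (koszulHomotopy_mem (hDm i) hf'm), ?_⟩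
    intro l hl S hlS
    rw [map_add, ← sub_sub, ← hf', Pi.sub_apply]
    by_cases hli : l = i
    · subst hli
      rw [koszulDiff_koszulHomotopy (hD l) (hD' l) hf'0 hlS, sub_self]
    · have hlT := (Finset.mem_insert.1 hl).resolve_left hli
      rw [koszulDiff_koszulHomotopy_eq_zero hli _ (hgf l hlT) hlS, hgf l hlT S hlS, sub_zero]

end Homotopy

/-- Division by `xᵢ` in a free module, forgetting the terms not divisible by `xᵢ`. -/
def divX {r : ℕ} (i : Fin n) :
    (Fin r → MvPolynomial (Fin n) k) →+ (Fin r → MvPolynomial (Fin n) k) where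
  toFun v a := (v a).divMonomial (Finsupp.single i 1)
  map_zero' := by
    ext1 a
    exact zero_divMonomial _
  map_add' v w := by
    ext1 a
    exact add_divMonomial _ _ _

theorem divX_X_smul {r : ℕ} (i : Fin n) (v : Fin r → MvPolynomial (Fin n) k) :
    divX i ((X i : MvPolynomial (Fin n) k) • v) = v :=
  funext fun _ => X_mul_divMonomial _ _

theorem divX_X_smul_of_ne {r : ℕ} {i l : Fin n} (h : l ≠ i) (v : Fin r → MvPolynomial (Fin n) k) :
    divX i ((X l : MvPolynomial (Fin n) k) • v) = (X l : MvPolynomial (Fin n) k) • divX i v := by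
  ext a m
  simp only [divX, AddMonoidHom.coe_mk, ZeroHom.coe_mk, Pi.smul_apply, smul_eq_mul,
    coeff_divMonomial, coeff_X_mul']
  have : l ∈ (Finsupp.single i 1 + m).support ↔ l ∈ m.support := by
    simp [h.symm]
  simp only [this]
  split_ifs with hl
  · congr 1
    rw [add_tsub_assoc_of_le]
    simpa [Nat.one_le_iff_ne_zero] using hl
  · rfl

theorem koszul_free_acyclic {r : ℕ} {deg : Fin r → ℤ} {p : ℕ} {j : ℤ}
    {f : Finset (Fin n) → Fin r → MvPolynomial (Fin n) k}
    (hf : f ∈ koszulPiece (freePiece deg) (p + 1) j) (h0 : koszulDiff k _ f = 0) :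
    ∃ g ∈ koszulPiece (freePiece deg) (p + 1 + 1) j, koszulDiff k _ g = f := by
  refine koszul_acyclic divX divX_X_smul (fun i l h => divX_X_smul_of_ne h)
    (fun d v hv => X_smul_mem_freePiece hv) (fun i d v hv => ?_) hf h0
  rw [mem_freePiece] at *
  exact fun a => divMonomial_mem_polyPiece (by have := hv a; rwa [add_sub_right_comm] at this) i

/-! ### Dimensions of subquotients -/

section Subquotient

variable {E U W : Type*} [AddCommGroup E] [Module k E] [AddCommGroup U] [Module k U]
  [AddCommGroup W] [Module k W]

/-- The dimension of the subquotient `Z / (B ∩ Z)`. -/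
def subquotDim (Z B : Submodule k U) : ℕ := Module.finrank k (Z ⧸ B.submoduleOf Z)

/-- The two hypotheses say that u induces a surjection from X to Z / (B ∩ Z), whose kernel is the
preimage of B. -/
theorem subquotDim_eq_finrank {X : Submodule k E} {u : E →ₗ[k] U} {Z B : Submodule k U}
    (hu : ∀ x ∈ X, u x ∈ Z) (hs : ∀ z ∈ Z, ∃ x ∈ X, z - u x ∈ B) :
    subquotDim Z B = Module.finrank k (X ⧸ (B.comap u).submoduleOf X) := by
  let φ : X →ₗ[k] Z ⧸ B.submoduleOf Z := (B.submoduleOf Z).mkQ ∘ₗ u.restrict hu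
  have hφ : Function.Surjective φ := by
    intro y
    obtain ⟨⟨z, hz⟩, rfl⟩ := Submodule.mkQ_surjective _ y
    obtain ⟨x, hx, hxz⟩ := hs z hz
    refine ⟨⟨x, hx⟩, ?_⟩
    rw [LinearMap.comp_apply, eq_comm, ← sub_eq_zero, ← map_sub, Submodule.mkQ_apply,
      Submodule.Quotient.mk_eq_zero]
    exact hxz
  have hk : LinearMap.ker φ = (B.comap u).submoduleOf X := by
    ext x
    rw [LinearMap.mem_ker, LinearMap.comp_apply, Submodule.mkQ_apply,
      Submodule.Quotient.mk_eq_zero]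
    rfl
  rw [← hk]
  exact (φ.quotKerEquivOfSurjective hφ).finrank_eq.symm

/-- Compares two subquotients through a common cover X with equal kernels. It serves for connecting
maps, which are thus never defined by a choice of lifts. -/
theorem subquotDim_eq_of_correspondence (X : Submodule k E) (u : E →ₗ[k] U) (v : E →ₗ[k] W)
    {Z B : Submodule k U} {Z' B' : Submodule k W}
    (hu : ∀ x ∈ X, u x ∈ Z) (hv : ∀ x ∈ X, v x ∈ Z')
    (hus : ∀ z ∈ Z, ∃ x ∈ X, z - u x ∈ B) (hvs : ∀ z ∈ Z', ∃ x ∈ X, z - v x ∈ B')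
    (h : ∀ x ∈ X, u x ∈ B ↔ v x ∈ B') : subquotDim Z B = subquotDim Z' B' := by
  rw [subquotDim_eq_finrank hu hus, subquotDim_eq_finrank hv hvs]
  have : (B.comap u).submoduleOf X = (B'.comap v).submoduleOf X := by
    ext ⟨x, hx⟩
    exact h x hx
  rw [this]

theorem subquotDim_top_bot : subquotDim (⊤ : Submodule k U) ⊥ = Module.finrank k U := by
  rw [subquotDim, Submodule.submoduleOf, Submodule.comap_bot, Submodule.ker_subtype]
  exact ((Submodule.quotEquivOfEqBot _ rfl).trans Submodule.topEquiv).finrank_eq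

theorem subquotDim_bot_left (B : Submodule k U) : subquotDim ⊥ B = 0 := by
  rw [subquotDim]
  exact Module.finrank_zero_of_subsingleton

end Subquotient

/-! ### Dimensions of Koszul homology -/

section HomDim

variable {N : Type*} [AddCommGroup N] [Module k N] [Module (MvPolynomial (Fin n) k) N]
  [IsScalarTower k (MvPolynomial (Fin n) k) N]

variable (n) in
/-- The dimension of the degree `j` part of the `p`-th Koszul homology of a graded module. -/
def koszulHomDim (𝓝 : ℤ → Submodule k N) (p : ℕ) (j : ℤ) : ℕ :=
  subquotDim (koszulPiece 𝓝 p j ⊓ LinearMap.ker (koszulDiff (n := n) k N))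
    ((koszulPiece 𝓝 (p + 1) j).map (koszulDiff k N))

theorem koszulHomDim_eq_zero {𝓝 : ℤ → Submodule k N} {p : ℕ} {j : ℤ}
    (h : koszulPiece (n := n) 𝓝 p j = ⊥) : koszulHomDim n 𝓝 p j = 0 := by
  rw [koszulHomDim, h, bot_inf_eq, subquotDim_bot_left]

/-- The map induced on Koszul complexes by a linear map. -/
def koszulMap {r : ℕ} (g : (Fin r → MvPolynomial (Fin n) k) →ₗ[MvPolynomial (Fin n) k] N) :
    (Finset (Fin n) → Fin r → MvPolynomial (Fin n) k) →ₗ[k] (Finset (Fin n) → N) :=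
  (g.restrictScalars k).compLeft _

theorem koszulMap_apply {r : ℕ}
    (g : (Fin r → MvPolynomial (Fin n) k) →ₗ[MvPolynomial (Fin n) k] N)
    (f : Finset (Fin n) → Fin r → MvPolynomial (Fin n) k) (S : Finset (Fin n)) :
    koszulMap g f S = g (f S) := rfl

theorem koszulDiff_koszulMap {r : ℕ}
    (g : (Fin r → MvPolynomial (Fin n) k) →ₗ[MvPolynomial (Fin n) k] N)
    (f : Finset (Fin n) → Fin r → MvPolynomial (Fin n) k) :
    koszulDiff k N (koszulMap g f) = koszulMap g (koszulDiff k _ f) :=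
  koszulDiff_comp g f

/-- The degree `d` part of the kernel of a map from a graded free module. -/
def syzPiece {r : ℕ} (deg : Fin r → ℤ)
    (g : (Fin r → MvPolynomial (Fin n) k) →ₗ[MvPolynomial (Fin n) k] N) (d : ℤ) :
    Submodule k (Fin r → MvPolynomial (Fin n) k) :=
  freePiece deg d ⊓ (LinearMap.ker g).restrictScalars k

variable {r : ℕ} {deg : Fin r → ℤ} {𝓝 : ℤ → Submodule k N}
  {g : (Fin r → MvPolynomial (Fin n) k) →ₗ[MvPolynomial (Fin n) k] N}

theorem mem_koszulPiece_syzPiece {p : ℕ} {j : ℤ}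
    {f : Finset (Fin n) → Fin r → MvPolynomial (Fin n) k} :
    f ∈ koszulPiece (syzPiece deg g) p j ↔
      f ∈ koszulPiece (freePiece deg) p j ∧ koszulMap g f = 0 := by
  simp only [mem_koszulPiece]
  constructor
  · rintro ⟨h1, h2⟩
    refine ⟨⟨fun S hS => (h1 S hS).1, h2⟩, funext fun S => ?_⟩
    by_cases hS : S.card = p
    · exact (h1 S hS).2
    · rw [koszulMap_apply, h2 S hS, map_zero, Pi.zero_apply]
  · rintro ⟨⟨h1, h2⟩, h3⟩
    exact ⟨fun S hS => ⟨h1 S hS, congrFun h3 S⟩, h2⟩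

theorem koszulMap_mem (hg : ∀ j, ∀ v ∈ freePiece deg j, g v ∈ 𝓝 j) {p : ℕ} {j : ℤ}
    {f : Finset (Fin n) → Fin r → MvPolynomial (Fin n) k}
    (hf : f ∈ koszulPiece (freePiece deg) p j) : koszulMap g f ∈ koszulPiece 𝓝 p j := by
  rw [mem_koszulPiece] at *
  exact ⟨fun S hS => hg _ _ (hf.1 S hS),
    fun S hS => by rw [koszulMap_apply, hf.2 S hS, map_zero]⟩

theorem exists_koszulMap_eq (hg : ∀ j, ∀ w ∈ 𝓝 j, ∃ v ∈ freePiece deg j, g v = w) {p : ℕ} {j : ℤ}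
    {c : Finset (Fin n) → N} (hc : c ∈ koszulPiece 𝓝 p j) :
    ∃ b ∈ koszulPiece (freePiece deg) p j, koszulMap g b = c := by
  rw [mem_koszulPiece] at hc
  choose! b hb using fun S (hS : S.card = p) => hg _ _ (hc.1 S hS)
  refine ⟨fun S => if S.card = p then b S else 0, ?_, ?_⟩
  · rw [mem_koszulPiece]
    exact ⟨fun S hS => by rw [if_pos hS]; exact (hb S hS).1, fun S hS => if_neg hS⟩
  · ext1 S
    rw [koszulMap_apply]
    split_ifs with hS
    · exact (hb S hS).2
    · rw [map_zero, hc.2 S hS]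

/-- The image of K₁ → K₀ is (x₁, …, xₙ)F, and the preimage can be kept in the same internal degree.
-/
theorem exists_koszulDiff_eq_of_mem_maxIdeal {j : ℤ}
    {a : Finset (Fin n) → Fin r → MvPolynomial (Fin n) k}
    (ha : a ∈ koszulPiece (freePiece deg) 0 j) (hm : ∀ c, a ∅ c ∈ maxIdeal k n) :
    ∃ b ∈ koszulPiece (freePiece deg) 1 j, koszulDiff k _ b = a := by
  have ha' := mem_koszulPiece.1 ha
  have h0 := mem_freePiece.1 (ha'.1 ∅ Finset.card_empty)
  choose w hw hw' using fun c => exists_eq_sum_X_mul (h0 c) (hm c)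
  -- The sum of indicators encodes the chain with coefficient w · i at {i} and zero at all other
  -- sets.
  let b : Finset (Fin n) → Fin r → MvPolynomial (Fin n) k :=
    fun S => ∑ i, if S = {i} then fun c => w c i else 0
  have hb1 : ∀ i, b {i} = fun c => w c i := by
    intro i
    simp only [b, Finset.singleton_inj]
    rw [Finset.sum_ite_eq]
    simp
  have hb : b ∈ koszulPiece (freePiece deg) 1 j := by
    rw [mem_koszulPiece]
    constructor
    · intro S hS
      obtain ⟨i, rfl⟩ := Finset.card_eq_one.1 hS
      rw [hb1, mem_freePiece]
      intro c
      convert hw c i using 2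
      push_cast
      ring
    · intro S hS
      refine Finset.sum_eq_zero fun i _ => if_neg ?_
      rintro rfl
      exact hS (Finset.card_singleton i)
  refine ⟨b, hb, ?_⟩
  ext1 S
  by_cases hS : S.card = 0
  · rw [Finset.card_eq_zero.1 hS]
    ext1 c
    rw [hw' c, koszulDiff_apply, Finset.compl_empty, Finset.sum_apply]
    refine Finset.sum_congr rfl fun i _ => ?_
    rw [insert_empty_eq, hb1]
    simp [koszulSign]
  · have hd : koszulDiff k _ b ∈ koszulPiece (freePiece deg) 0 j :=
      koszulDiff_mem (fun d v hv => X_smul_mem_freePiece hv) hb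
    rw [ha'.2 S hS, (mem_koszulPiece.1 hd).2 S hS]

/-- Dimension shifting: Koszul homology of a graded module versus that of its first syzygy module. -/
theorem koszulHomDim_succ (hg : ∀ j, ∀ v ∈ freePiece deg j, g v ∈ 𝓝 j)
    (hg' : ∀ j, ∀ w ∈ 𝓝 j, ∃ v ∈ freePiece deg j, g v = w)
    (hmin : ∀ v, g v = 0 → ∀ a, v a ∈ maxIdeal k n) (p : ℕ) (j : ℤ) :
    koszulHomDim n 𝓝 (p + 1) j = koszulHomDim n (syzPiece deg g) p j := by
  have hX : ∀ d, ∀ v ∈ freePiece (k := k) (n := n) deg d, ∀ i,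
      (X i : MvPolynomial (Fin n) k) • v ∈ freePiece deg (d + 1) :=
    fun d v hv => X_smul_mem_freePiece hv
  -- The connecting map as a correspondence: X consists of the chains over the free module whose
  -- boundary dies in N. Mapped to N they give cycles, and their boundaries are cycles over the
  -- syzygies.
  refine subquotDim_eq_of_correspondence
    (koszulPiece (freePiece deg) (p + 1) j ⊓
      LinearMap.ker (koszulMap g ∘ₗ koszulDiff k (Fin r → MvPolynomial (Fin n) k)))
    (koszulMap g) (koszulDiff k _) ?_ ?_ ?_ ?_ ?_
  · rintro x ⟨hx, hx'⟩
    refine ⟨koszulMap_mem hg hx, ?_⟩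
    rw [SetLike.mem_coe, LinearMap.mem_ker, koszulDiff_koszulMap]
    exact hx'
  · rintro x ⟨hx, hx'⟩
    exact ⟨mem_koszulPiece_syzPiece.2 ⟨koszulDiff_mem hX hx, hx'⟩, koszulDiff_koszulDiff x⟩
  · rintro z ⟨hz, hz'⟩
    obtain ⟨b, hb, rfl⟩ := exists_koszulMap_eq hg' hz
    refine ⟨b, ⟨hb, ?_⟩, ?_⟩
    · rw [SetLike.mem_coe, LinearMap.mem_ker, LinearMap.comp_apply, ← koszulDiff_koszulMap]
      exact hz'
    · rw [sub_self]
      exact zero_mem _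
  · rintro z ⟨hz, hz'⟩
    obtain ⟨hz1, hz2⟩ := mem_koszulPiece_syzPiece.1 hz
    obtain ⟨b, hb, rfl⟩ : ∃ b ∈ koszulPiece (freePiece deg) (p + 1) j, koszulDiff k _ b = z := by
      -- At p = 0 the Koszul complex of the free module is not exact; minimality puts the syzygy in
      -- (x₁, …, xₙ)F, the image of K₁.
      cases p with
      | zero => exact exists_koszulDiff_eq_of_mem_maxIdeal hz1 (hmin _ (congrFun hz2 ∅))
      | succ p => exact koszul_free_acyclic hz1 hz'
    refine ⟨b, ⟨hb, hz2⟩, ?_⟩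
    rw [sub_self]
    exact zero_mem _
  · rintro x ⟨hx, hx'⟩
    constructor
    · rintro ⟨c, hc, hcx⟩
      obtain ⟨b, hb, rfl⟩ := exists_koszulMap_eq hg' hc
      refine ⟨x - koszulDiff k _ b, mem_koszulPiece_syzPiece.2
        ⟨sub_mem hx (koszulDiff_mem hX hb), ?_⟩, ?_⟩
      · rw [map_sub, ← koszulDiff_koszulMap, hcx, sub_self]
      · rw [map_sub, koszulDiff_koszulDiff, sub_zero]
    · rintro ⟨a, ha, hax⟩
      obtain ⟨ha1, ha2⟩ := mem_koszulPiece_syzPiece.1 ha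
      -- The chains x and a have the same boundary, so x - a is a cycle over the free module in
      -- positive homological degree, hence a boundary; and a dies in N.
      obtain ⟨b, hb, hbx⟩ := koszul_free_acyclic (sub_mem hx ha1)
        (by rw [map_sub, hax, sub_self])
      refine ⟨koszulMap g b, koszulMap_mem hg hb, ?_⟩
      rw [koszulDiff_koszulMap, hbx, map_sub, ha2, sub_zero]

/-- The zeroth Koszul homology counts minimal generators. -/
theorem koszulHomDim_zero (hg : ∀ j, ∀ v ∈ freePiece deg j, g v ∈ 𝓝 j)
    (hg' : ∀ j, ∀ w ∈ 𝓝 j, ∃ v ∈ freePiece deg j, g v = w)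
    (hmin : ∀ v, g v = 0 → ∀ a, v a ∈ maxIdeal k n) (j : ℤ) :
    koszulHomDim n 𝓝 0 j = (Finset.univ.filter fun a => deg a = j).card := by
  have hX : ∀ d, ∀ v ∈ freePiece (k := k) (n := n) deg d, ∀ i,
      (X i : MvPolynomial (Fin n) k) • v ∈ freePiece deg (d + 1) :=
    fun d v hv => X_smul_mem_freePiece hv
  have hcard : (Finset.univ.filter fun a => deg a = j).card =
      subquotDim (⊤ : Submodule k ({a // deg a = j} → k)) ⊥ := by
    rw [subquotDim_top_bot, Module.finrank_fintype_fun_eq_card, Fintype.card_subtype]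
  rw [hcard]
  -- Degree j elements of the free module are compared with their constant terms at the basis
  -- vectors of degree j.
  refine subquotDim_eq_of_correspondence (koszulPiece (freePiece deg) 0 j) (koszulMap g)
    (LinearMap.pi fun a : {a // deg a = j} => lcoeff k 0 ∘ₗ LinearMap.proj a.1 ∘ₗ LinearMap.proj ∅) ?_ ?_ ?_ ?_ ?_
  · intro x hx
    refine ⟨koszulMap_mem hg hx, ?_⟩
    rw [SetLike.mem_coe, LinearMap.mem_ker, koszulDiff_koszulMap]
    convert map_zero (koszulMap g)
    ext1 S
    rw [koszulDiff_apply]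
    refine Finset.sum_eq_zero fun i hi => ?_
    rw [(mem_koszulPiece.1 hx).2 (insert i S) (by simp), smul_zero, smul_zero]
  · exact fun x _ => trivial
  · rintro z ⟨hz, -⟩
    obtain ⟨b, hb, rfl⟩ := exists_koszulMap_eq hg' hz
    refine ⟨b, hb, ?_⟩
    rw [sub_self]
    exact zero_mem _
  · rintro z -
    refine ⟨fun S => if S.card = 0 then
      fun a => if h : deg a = j then C (z ⟨a, h⟩) else 0 else 0, ?_, ?_⟩
    · rw [mem_koszulPiece]
      refine ⟨fun S hS => ?_, fun S hS => if_neg hS⟩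
      rw [if_pos hS, mem_freePiece]
      intro a
      split_ifs with h
      · subst h
        simpa using monomial_mem_polyPiece (0 : Fin n →₀ ℕ) (z ⟨a, rfl⟩)
      · exact zero_mem _
    · rw [Submodule.mem_bot, sub_eq_zero]
      ext ⟨a, ha⟩
      simp [ha]
  · intro x hx
    rw [Submodule.mem_bot]
    -- Both kernels are the degree j part of (x₁, …, xₙ)F; minimality is what excludes further
    -- relations.
    trans ∀ a, x ∅ a ∈ maxIdeal k n
    · constructor
      · rintro ⟨c, hc, hcx⟩
        obtain ⟨b, hb, rfl⟩ := exists_koszulMap_eq hg' hc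
        intro a
        have h1 : g (x ∅ - koszulDiff k _ b ∅) = 0 := by
          have := congrFun hcx ∅
          rw [koszulDiff_koszulMap, koszulMap_apply, koszulMap_apply] at this
          rw [map_sub, this, sub_self]
        have h2 := hmin _ h1 a
        have h3 : koszulDiff k _ b ∅ a ∈ maxIdeal k n := by
          rw [koszulDiff_apply, Finset.sum_apply]
          refine Ideal.sum_mem _ fun i _ => zsmul_mem ?_ _
          exact Ideal.mul_mem_right _ _ (Ideal.subset_span ⟨i, rfl⟩)
        simpa using add_mem h2 h3
      · intro h
        obtain ⟨b, hb, hbx⟩ := exists_koszulDiff_eq_of_mem_maxIdeal hx h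
        refine ⟨koszulMap g b, koszulMap_mem hg hb, ?_⟩
        rw [koszulDiff_koszulMap, hbx]
    · constructor
      · intro h
        ext ⟨a, ha⟩
        exact mem_maxIdeal.1 (h a)
      · intro h a
        rw [mem_maxIdeal]
        by_cases ha : deg a = j
        · exact congrFun h ⟨a, ha⟩
        -- A coefficient at a basis vector of degree other than j is homogeneous of nonzero degree,
        -- so it has no constant term.
        · have h1 := mem_freePiece.1 ((mem_koszulPiece.1 hx).1 ∅ Finset.card_empty) a
          by_contra h2
          have := mem_polyPiece.1 h1 0 h2
          simp at this
          omega

end HomDim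

/-! ### Betti numbers as dimensions of Koszul homology -/

namespace MinimalResolution

variable {M : Type*} [AddCommGroup M] [Module k M] [Module (MvPolynomial (Fin n) k) M]
  {𝓜 : ℤ → Submodule k M} (F : MinimalResolution (n := n) 𝓜)

/-- The degree `d` part of the `(i + 1)`-st syzygy module, as a submodule of `Fᵢ`. -/
def boundaryPiece (i : ℕ) (d : ℤ) : Submodule k (Fin (F.rank i) → MvPolynomial (Fin n) k) :=
  freePiece (F.deg i) d ⊓ (LinearMap.range (F.d i)).restrictScalars k

theorem syzPiece_aug : syzPiece (F.deg 0) F.aug = F.boundaryPiece 0 := by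
  ext j : 1
  rw [syzPiece, boundaryPiece, F.exact_aug.linearMap_ker_eq]

theorem syzPiece_d (i : ℕ) : syzPiece (F.deg (i + 1)) (F.d i) = F.boundaryPiece (i + 1) := by
  ext j : 1
  rw [syzPiece, boundaryPiece, (F.exact_d i).linearMap_ker_eq]

theorem mem_maxIdeal_of_aug {v : Fin (F.rank 0) → MvPolynomial (Fin n) k} (hv : F.aug v = 0)
    (a : Fin (F.rank 0)) : v a ∈ maxIdeal k n := by
  obtain ⟨w, rfl⟩ := (F.exact_aug v).1 hv
  exact F.minimal 0 w a

theorem mem_maxIdeal_of_d {i : ℕ} {v : Fin (F.rank (i + 1)) → MvPolynomial (Fin n) k}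
    (hv : F.d i v = 0) (a : Fin (F.rank (i + 1))) : v a ∈ maxIdeal k n := by
  obtain ⟨w, rfl⟩ := (F.exact_d i v).1 hv
  exact F.minimal (i + 1) w a

theorem d_mem_boundaryPiece {i : ℕ} {j : ℤ} {v : Fin (F.rank (i + 1)) → MvPolynomial (Fin n) k}
    (hv : v ∈ freePiece (F.deg (i + 1)) j) : F.d i v ∈ F.boundaryPiece i j :=
  ⟨F.d_mem i j v hv, ⟨v, rfl⟩⟩

theorem exists_of_mem_boundaryPiece {i : ℕ} {j : ℤ} {w : Fin (F.rank i) → MvPolynomial (Fin n) k}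
    (hw : w ∈ F.boundaryPiece i j) : ∃ v ∈ freePiece (F.deg (i + 1)) j, F.d i v = w := by
  obtain ⟨hw, v, rfl⟩ := hw
  refine ⟨freeComp (F.deg (i + 1)) j v, freeComp_mem _ _ _, ?_⟩
  rw [map_freeComp _ (F.d_mem i), freeComp_of_mem hw]

/-- Each shift trades one Koszul degree for one step along the resolution. The extra 1 appears
because the boundaries in Fᵢ are minimally generated by the basis of Fᵢ₊₁. -/
theorem koszulHomDim_boundaryPiece (p i : ℕ) (j : ℤ) :
    koszulHomDim n (F.boundaryPiece i) p j = F.betti (i + p + 1) j := by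
  induction p generalizing i with
  | zero =>
    exact koszulHomDim_zero (fun _ _ => F.d_mem_boundaryPiece)
      (fun _ _ => F.exists_of_mem_boundaryPiece) (fun _ => F.mem_maxIdeal_of_d) j
  | succ p ih =>
    rw [koszulHomDim_succ (fun _ _ => F.d_mem_boundaryPiece)
      (fun _ _ => F.exists_of_mem_boundaryPiece) (fun _ => F.mem_maxIdeal_of_d), syzPiece_d, ih,
      add_right_comm i 1 p, add_assoc i p 1]

variable [IsScalarTower k (MvPolynomial (Fin n) k) M]

/-- The graded Betti numbers are the dimensions of the graded pieces of Koszul homology. -/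
theorem betti_eq_koszulHomDim (h : ∀ j, ∀ w ∈ 𝓜 j, ∃ v ∈ freePiece (F.deg 0) j, F.aug v = w)
    (p : ℕ) (j : ℤ) : F.betti p j = koszulHomDim n 𝓜 p j := by
  cases p with
  | zero => exact (koszulHomDim_zero F.aug_mem h (fun _ => F.mem_maxIdeal_of_aug) j).symm
  | succ p =>
    rw [koszulHomDim_succ F.aug_mem h (fun _ => F.mem_maxIdeal_of_aug), syzPiece_aug,
      koszulHomDim_boundaryPiece, zero_add]

end MinimalResolution

/-! ### Existence of minimal graded free resolutions -/

theorem mul_mem_polyPiece {d e : ℤ} {f g : MvPolynomial (Fin n) k} (hf : f ∈ polyPiece k n d)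
    (hg : g ∈ polyPiece k n e) : f * g ∈ polyPiece k n (d + e) := by
  rw [mem_polyPiece] at *
  intro m hm
  rw [coeff_mul] at hm
  obtain ⟨⟨a, b⟩, hab, h⟩ := Finset.exists_ne_zero_of_sum_ne_zero hm
  rw [← Finset.HasAntidiagonal.mem_antidiagonal.1 hab, map_add, ← hf a (left_ne_zero_of_mul h),
    ← hg b (right_ne_zero_of_mul h)]
  push_cast
  rfl

theorem exists_finset_sum_freeComp {r : ℕ} (deg : Fin r → ℤ) (v : Fin r → MvPolynomial (Fin n) k) :
    ∃ J : Finset ℤ, ∑ j ∈ J, freeComp deg j v = v := by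
  -- Allowing every larger index set lets the induction pass to sums, using the union of the two
  -- sets.
  suffices H : ∃ J : Finset ℤ, ∀ J', J ⊆ J' → ∑ j ∈ J', freeComp deg j v = v by
    obtain ⟨J, hJ⟩ := H
    exact ⟨J, hJ J subset_rfl⟩
  induction v using freePiece_induction deg with
  | mem j v hv =>
    refine ⟨{j}, fun J' hJ' => ?_⟩
    rw [Finset.sum_eq_single_of_mem j (hJ' (Finset.mem_singleton_self j)), freeComp_of_mem hv]
    exact fun i _ hi => freeComp_of_mem_ne hi hv
  | zero => exact ⟨∅, fun J' _ => by simp⟩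
  | add v w hv hw =>
    obtain ⟨J, hJ⟩ := hv
    obtain ⟨K, hK⟩ := hw
    refine ⟨J ∪ K, fun J' hJ' => ?_⟩
    simp only [map_add, Finset.sum_add_distrib]
    rw [hJ J' (Finset.union_subset_left hJ'), hK J' (Finset.union_subset_right hJ')]

/-- The homogeneous elements of N span it, being the components of its elements; by Noetherianity
finitely many of them suffice. -/
theorem exists_homogeneous_generators {r : ℕ} (deg : Fin r → ℤ)
    (N : Submodule (MvPolynomial (Fin n) k) (Fin r → MvPolynomial (Fin n) k))
    (hN : ∀ j, ∀ v ∈ N, freeComp deg j v ∈ N) :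
    ∃ (s : ℕ) (e : Fin s → ℤ) (g : Fin s → Fin r → MvPolynomial (Fin n) k),
      (∀ a, g a ∈ freePiece deg (e a)) ∧
        Submodule.span (MvPolynomial (Fin n) k) (Set.range g) = N := by
  have hspan : Submodule.span (MvPolynomial (Fin n) k)
      {v | v ∈ N ∧ ∃ j, v ∈ freePiece (k := k) (n := n) deg j} = N := by
    refine le_antisymm (Submodule.span_le.2 fun v hv => hv.1) fun v hv => ?_
    obtain ⟨J, hJ⟩ := exists_finset_sum_freeComp deg v
    rw [← hJ]
    exact Submodule.sum_mem _ fun j _ =>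
      Submodule.subset_span ⟨hN j v hv, j, freeComp_mem deg j v⟩
  have hfg : N.FG := IsNoetherian.noetherian N
  rw [← hspan] at hfg
  obtain ⟨t, ht, hts⟩ := Submodule.fg_span_iff_fg_span_finset_subset _ |>.1 hfg
  choose e he using fun a => (ht (t.equivFin.symm a).2).2
  refine ⟨t.card, e, fun a => (t.equivFin.symm a).1, he, ?_⟩
  rw [← hspan, hts]
  congr 1
  ext v
  constructor
  · rintro ⟨a, rfl⟩
    exact (t.equivFin.symm a).2
  · intro hv
    exact ⟨t.equivFin ⟨v, hv⟩, by simp⟩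

/-- A graded submodule of a graded free module has a minimal graded free cover. -/
theorem exists_minimal_cover {r : ℕ} (deg : Fin r → ℤ)
    (N : Submodule (MvPolynomial (Fin n) k) (Fin r → MvPolynomial (Fin n) k))
    (hN : ∀ j, ∀ v ∈ N, freeComp deg j v ∈ N) :
    ∃ (s : ℕ) (e : Fin s → ℤ) (φ : (Fin s → MvPolynomial (Fin n) k) →ₗ[MvPolynomial (Fin n) k]
        (Fin r → MvPolynomial (Fin n) k)),
      (∀ j, ∀ v ∈ freePiece e j, φ v ∈ freePiece deg j) ∧ LinearMap.range φ = N ∧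
        ∀ v, φ v = 0 → ∀ a, v a ∈ maxIdeal k n := by
  classical
  -- The number s of homogeneous generators is taken as small as possible; a relation with a
  -- coefficient outside the maximal ideal would then make a generator redundant.
  have hex := exists_homogeneous_generators deg N hN
  have hspec := Nat.find_spec hex
  have hmin := fun s' => Nat.find_min hex (m := s')
  generalize Nat.find hex = s at hspec hmin
  obtain ⟨e, g, hg, hgN⟩ := hspec
  have hφ : ∀ j, ∀ v ∈ freePiece (k := k) (n := n) e j,
      Fintype.linearCombination (MvPolynomial (Fin n) k) g v ∈ freePiece deg j := by
    intro j v hv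
    rw [Fintype.linearCombination_apply]
    refine Submodule.sum_mem _ fun a _ => mem_freePiece.2 fun c => ?_
    have := mul_mem_polyPiece (mem_freePiece.1 hv a) (mem_freePiece.1 (hg a) c)
    rwa [sub_add_sub_cancel] at this
  refine ⟨s, e, Fintype.linearCombination (MvPolynomial (Fin n) k) g, hφ, ?_, ?_⟩
  · rw [Fintype.range_linearCombination, hgN]
  · intro v hv b
    by_contra hb
    -- The degree e b component of the relation has as its b-th coefficient the constant term of v
    -- b, a nonzero scalar.
    have hw := map_freeComp _ hφ (e b) v
    rw [hv, map_zero, Fintype.linearCombination_apply] at hw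
    have hc : (v b).coeff 0 ≠ 0 := fun h => hb (mem_maxIdeal.2 h)
    have hwb : freeComp e (e b) v b = C ((v b).coeff 0) := by
      ext m
      rw [freeComp_apply, coeff_polyComp, coeff_C, sub_self]
      by_cases hm : m = 0
      · subst hm
        simp
      · rw [if_neg (Ne.symm hm), if_neg]
        exact_mod_cast mt (Finsupp.degree_eq_zero_iff m).1 hm
    obtain ⟨s', hs'⟩ : ∃ s', s = s' + 1 := ⟨s - 1, by have := b.pos; omega⟩
    subst hs'
    -- Solving the relation for the b-th generator leaves s' homogeneous generators, against
    -- minimality.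
    refine hmin s' (Nat.lt_succ_self _) ⟨e ∘ b.succAbove, g ∘ b.succAbove, fun a => hg _, ?_⟩
    rw [← hgN]
    refine le_antisymm (Submodule.span_mono (Set.range_comp_subset_range _ _)) ?_
    rw [Submodule.span_le]
    rintro _ ⟨a, rfl⟩
    have hmem : ∀ c, g (b.succAbove c) ∈
        Submodule.span (MvPolynomial (Fin n) k) (Set.range (g ∘ b.succAbove)) :=
      fun c => Submodule.subset_span ⟨c, rfl⟩
    rcases Fin.eq_self_or_eq_succAbove b a with rfl | ⟨c, rfl⟩
    · rw [Fin.sum_univ_succAbove _ a, hwb] at hw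
      have h1 : g a = C (σ := Fin n) ((v a).coeff 0)⁻¹ • C (σ := Fin n) ((v a).coeff 0) • g a := by
        rw [smul_smul, ← C_mul, inv_mul_cancel₀ hc, C_1, one_smul]
      rw [SetLike.mem_coe, h1, eq_neg_of_add_eq_zero_left hw]
      exact Submodule.smul_mem _ _ (neg_mem (Submodule.sum_mem _ fun c _ =>
        Submodule.smul_mem _ _ (hmem c)))
    · exact hmem c

variable (k n) in
/-- A graded submodule, contained in `(x₁, …, xₙ) F`, of a graded free module `F`. -/
structure Syzygy where
  /-- the rank of the free module -/
  rank : ℕ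
  /-- the degrees of its basis vectors -/
  deg : Fin rank → ℤ
  /-- the submodule -/
  submodule : Submodule (MvPolynomial (Fin n) k) (Fin rank → MvPolynomial (Fin n) k)
  freeComp_mem : ∀ j, ∀ v ∈ submodule, freeComp deg j v ∈ submodule
  mem_maxIdeal : ∀ v ∈ submodule, ∀ a, v a ∈ maxIdeal k n

namespace Syzygy

variable (T : Syzygy k n)

/-- The rank of a minimal cover. -/
def coverRank : ℕ := (exists_minimal_cover T.deg T.submodule T.freeComp_mem).choose

/-- The degrees of the basis vectors of a minimal cover. -/
def coverDeg : Fin T.coverRank → ℤ :=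
  (exists_minimal_cover T.deg T.submodule T.freeComp_mem).choose_spec.choose

/-- A minimal cover. -/
def cover : (Fin T.coverRank → MvPolynomial (Fin n) k) →ₗ[MvPolynomial (Fin n) k]
    (Fin T.rank → MvPolynomial (Fin n) k) :=
  (exists_minimal_cover T.deg T.submodule T.freeComp_mem).choose_spec.choose_spec.choose

theorem cover_mem : ∀ j, ∀ v ∈ freePiece T.coverDeg j, T.cover v ∈ freePiece T.deg j :=
  (exists_minimal_cover T.deg T.submodule T.freeComp_mem).choose_spec.choose_spec.choose_spec.1

theorem range_cover : LinearMap.range T.cover = T.submodule :=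
  (exists_minimal_cover T.deg T.submodule T.freeComp_mem).choose_spec.choose_spec.choose_spec.2.1

theorem mem_maxIdeal_of_cover : ∀ v, T.cover v = 0 → ∀ a, v a ∈ maxIdeal k n :=
  (exists_minimal_cover T.deg T.submodule T.freeComp_mem).choose_spec.choose_spec.choose_spec.2.2

/-- The kernel of a minimal cover. -/
def next : Syzygy k n where
  rank := T.coverRank
  deg := T.coverDeg
  submodule := LinearMap.ker T.cover
  freeComp_mem j v hv := by
    rw [LinearMap.mem_ker] at *
    rw [map_freeComp _ T.cover_mem, hv, map_zero]
  mem_maxIdeal := T.mem_maxIdeal_of_cover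

theorem exact_next_cover : Function.Exact T.next.cover T.cover := by
  intro y
  have h := SetLike.ext_iff.1 T.next.range_cover y
  exact h.symm

/-- The successive syzygy modules. -/
def iter : ℕ → Syzygy k n
  | 0 => T
  | i + 1 => (iter i).next

end Syzygy

/-- The presentation `0 → I → R → R ⧸ I → 0`, for a homogeneous ideal `I`. -/
def idealSyzygy (I : Ideal (MvPolynomial (Fin n) k)) (hI : ∀ j, ∀ f ∈ I, polyComp k n j f ∈ I)
    (hm : I ≤ maxIdeal k n) : Syzygy k n where
  rank := 1
  deg _ := 0
  submodule := LinearMap.ker (I.mkQ ∘ₗ LinearMap.proj (0 : Fin 1))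
  freeComp_mem j v hv := by
    have hv' : v 0 ∈ I := Ideal.Quotient.eq_zero_iff_mem.1 hv
    exact Ideal.Quotient.eq_zero_iff_mem.2 (hI _ _ hv')
  mem_maxIdeal v hv a := by
    rw [Subsingleton.elim a 0]
    exact hm (Ideal.Quotient.eq_zero_iff_mem.1 hv)

/-- Iterates minimal covers of kernels, starting from R → R/I; `hm` is minimality at F₀ = R. -/
theorem nonempty_minimalResolution {I : Ideal (MvPolynomial (Fin n) k)}
    (hI : ∀ j, ∀ f ∈ I, polyComp k n j f ∈ I) (hm : I ≤ maxIdeal k n) :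
    Nonempty (MinimalResolution (n := n) (quotPiece I)) := by
  let T := idealSyzygy I hI hm
  exact ⟨{
    rank := fun i => (T.iter i).rank
    deg := fun i => (T.iter i).deg
    d := fun i => (T.iter i).cover
    aug := I.mkQ ∘ₗ LinearMap.proj (0 : Fin 1)
    d_mem := fun i => (T.iter i).cover_mem
    aug_mem := fun j v hv => by
      refine ⟨v (0 : Fin 1), ?_, rfl⟩
      have := mem_freePiece.1 hv (0 : Fin 1)
      change v (0 : Fin 1) ∈ polyPiece k n (j - 0) at this
      rwa [sub_zero] at this
    exact_d := fun i => (T.iter i).exact_next_cover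
    exact_aug := by
      intro y
      have h := SetLike.ext_iff.1 T.range_cover y
      exact h.symm
    aug_surjective := by
      intro y
      obtain ⟨f, rfl⟩ := I.mkQ_surjective y
      exact ⟨fun _ => f, rfl⟩
    minimal := fun i v => (T.iter i).mem_maxIdeal _ (by
      rw [← (T.iter i).range_cover]
      exact ⟨v, rfl⟩) }⟩

/-- The augmentation is only assumed to preserve degrees, so homogeneous lifts need an argument:
each value of `aug` gets a representing polynomial whose components represent the images of the
components, and homogeneity of I makes the choice of representative harmless. -/
theorem MinimalResolution.exists_aug_eq {I : Ideal (MvPolynomial (Fin n) k)}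
    (hI : ∀ j, ∀ f ∈ I, polyComp k n j f ∈ I) (F : MinimalResolution (n := n) (quotPiece I))
    (j : ℤ) (w : MvPolynomial (Fin n) k ⧸ I) (hw : w ∈ quotPiece I j) :
    ∃ v ∈ freePiece (F.deg 0) j, F.aug v = w := by
  have key : ∀ v, ∃ p, F.aug v = Ideal.Quotient.mk I p ∧
      ∀ j, F.aug (freeComp (F.deg 0) j v) = Ideal.Quotient.mk I (polyComp k n j p) := by
    intro v
    induction v using freePiece_induction (F.deg 0) with
    | mem j' v hv =>
      obtain ⟨p, hp, hpv⟩ := F.aug_mem _ _ hv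
      refine ⟨p, hpv.symm, fun j => ?_⟩
      by_cases h : j = j'
      · subst h
        rw [freeComp_of_mem hv, polyComp_of_mem hp]
        exact hpv.symm
      · rw [freeComp_of_mem_ne h hv, polyComp_of_mem_ne h hp, map_zero, map_zero]
    | zero => exact ⟨0, by simp, by simp⟩
    | add v w hv hw =>
      obtain ⟨p, hp, hp'⟩ := hv
      obtain ⟨q, hq, hq'⟩ := hw
      refine ⟨p + q, ?_, fun j => ?_⟩
      · rw [map_add, map_add, hp, hq]
      · rw [map_add, map_add, map_add, map_add, hp', hq']
  obtain ⟨q, hq, rfl⟩ := hw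
  obtain ⟨v, hv⟩ := F.aug_surjective (Ideal.Quotient.mk I q)
  obtain ⟨p, hp, hp'⟩ := key v
  refine ⟨freeComp (F.deg 0) j v, freeComp_mem _ _ _, ?_⟩
  rw [hp']
  change _ = Ideal.Quotient.mk I q
  have h := hI j _ (Ideal.Quotient.eq.1 (hp.symm.trans hv))
  rw [map_sub, polyComp_of_mem hq] at h
  exact Ideal.Quotient.eq.2 h

end GradedRes

/-! ### Independent sets, facets and the independence number -/

namespace Hypergraph

variable {n : ℕ} {H : Hypergraph (Fin n)}

theorem isIndependent_iff (hV : H.vertexSet = Set.univ) {W : Finset (Fin n)} :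
    H.IsIndependent W ↔ ∀ E : Finset (Fin n), (E : Set (Fin n)) ∈ H.edgeSet → ¬ E ⊆ W := by
  constructor
  · intro h E hE hEW
    exact h.2 _ hE (Finset.coe_subset.2 hEW)
  · intro h
    refine ⟨by rw [hV]; exact Set.subset_univ _, fun e he heW => ?_⟩
    refine h (Set.toFinite e).toFinset (by simpa using he) ?_
    simpa [← Finset.coe_subset] using heW

theorem mem_maximalIndependentSets_iff (hV : H.vertexSet = Set.univ) {W : Finset (Fin n)} :
    W ∈ H.maximalIndependentSets ↔ H.IsIndependent W ∧ ∀ v ∉ W, ∃ E : Finset (Fin n),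
      (E : Set (Fin n)) ∈ H.edgeSet ∧ E ⊆ insert v W := by
  unfold maximalIndependentSets
  rw [Set.mem_ofPred_eq, hV]
  refine and_congr_right fun _ => forall_congr' fun v => ?_
  rw [imp_iff_right (Set.mem_univ v)]
  refine imp_congr_right fun _ => ?_
  constructor
  · rintro ⟨e, he, hs⟩
    refine ⟨(Set.toFinite e).toFinset, by simpa using he, ?_⟩
    rw [← Finset.coe_subset]
    simpa using hs
  · rintro ⟨E, hE, hs⟩
    refine ⟨E, hE, ?_⟩
    rw [← Finset.coe_subset] at hs
    simpa using hs

/-- Testing one-vertex extensions suffices, since subsets of independent sets are independent. -/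
theorem facets_independenceComplex (hV : H.vertexSet = Set.univ) :
    SimplicialFamily.facets H.independenceComplex = H.maximalIndependentSets := by
  ext W
  rw [mem_maximalIndependentSets_iff hV]
  change Maximal (fun G => H.IsIndependent G) W ↔ _
  constructor
  · intro h
    refine ⟨h.prop, fun v hv => ?_⟩
    by_contra! hc
    have hi : H.IsIndependent (insert v W) := (isIndependent_iff hV).2 hc
    exact hv (h.le_of_ge hi (Finset.subset_insert v W) (Finset.mem_insert_self v W))
  · rintro ⟨hW, h⟩
    refine ⟨hW, fun G hG hWG v hv => ?_⟩
    by_contra hvW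
    obtain ⟨E, hE, hEs⟩ := h v hvW
    exact (isIndependent_iff hV).1 hG E hE (hEs.trans (Finset.insert_subset hv hWG))

theorem exists_maximal_of_isIndependent (hV : H.vertexSet = Set.univ) {W : Finset (Fin n)}
    (hW : H.IsIndependent W) : ∃ G ∈ H.maximalIndependentSets, W ⊆ G := by
  rw [← facets_independenceComplex hV]
  obtain ⟨G, hWG, hG⟩ := Finite.exists_le_maximal (p := fun G => H.IsIndependent G) hW
  exact ⟨G, hG, hWG⟩

theorem isIndependent_empty (hV : H.vertexSet = Set.univ) (hH : H.IsSimple) :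
    H.IsIndependent ∅ := by
  rw [isIndependent_iff hV]
  intro E hE hs
  have := hH.1 _ hE
  rw [Finset.subset_empty.1 hs] at this
  simp at this

theorem card_le_independenceNumber {W : Finset (Fin n)} (hW : H.IsIndependent W) :
    W.card ≤ H.independenceNumber :=
  Finset.le_sup (f := Finset.card) (by simpa using hW)

theorem exists_maximal_card_eq (hV : H.vertexSet = Set.univ) (hH : H.IsSimple) :
    ∃ W ∈ H.maximalIndependentSets, W.card = H.independenceNumber := by
  classical
  obtain ⟨W, hW, hc⟩ := Finset.exists_mem_eq_sup (Finset.univ.filter fun W => H.IsIndependent W)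
    ⟨∅, by simpa using isIndependent_empty hV hH⟩ Finset.card
  obtain ⟨G, hG, hWG⟩ := exists_maximal_of_isIndependent hV (by simpa using hW)
  refine ⟨G, hG, le_antisymm
    (card_le_independenceNumber ((mem_maximalIndependentSets_iff hV).1 hG).1) ?_⟩
  have : H.independenceNumber = W.card := by
    rw [independenceNumber]
    convert hc
  rw [this]
  exact Finset.card_le_card hWG

end Hypergraph

namespace GradedRes

open MvPolynomial

variable {k : Type*} [Field k] {n : ℕ} {H : Hypergraph (Fin n)}

/-! ### The monomial ideals of a hypergraph -/

/-- The exponent vector of the squarefree monomial `∏_{i ∈ W} xᵢ`. -/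
def squarefreeExp (W : Finset (Fin n)) : Fin n →₀ ℕ := ∑ i ∈ W, Finsupp.single i 1

theorem squarefreeExp_apply (W : Finset (Fin n)) (i : Fin n) :
    squarefreeExp W i = if i ∈ W then 1 else 0 := by
  simp [squarefreeExp, Finsupp.finsetSum_apply, Finsupp.single_apply]

theorem degree_squarefreeExp (W : Finset (Fin n)) : (squarefreeExp W).degree = W.card := by
  simp [squarefreeExp]

theorem support_squarefreeExp (W : Finset (Fin n)) : (squarefreeExp W).support = W := by
  ext i
  simp [squarefreeExp_apply]

theorem squarefreeExp_injective : Function.Injective (squarefreeExp (n := n)) := fun W W' h => by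
  rw [← support_squarefreeExp W, h, support_squarefreeExp]

theorem squarefreeExp_le_iff {W : Finset (Fin n)} {m : Fin n →₀ ℕ} :
    squarefreeExp W ≤ m ↔ W ⊆ m.support := by
  constructor
  · intro h i hi
    have := h i
    rw [squarefreeExp_apply, if_pos hi] at this
    exact Finsupp.mem_support_iff.2 (by omega)
  · intro h i
    rw [squarefreeExp_apply]
    split_ifs with hi
    · exact Nat.one_le_iff_ne_zero.2 (Finsupp.mem_support_iff.1 (h hi))
    · exact Nat.zero_le _

theorem squarefreeExp_support {m : Fin n →₀ ℕ} (h : ∀ i, m i < 2) :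
    squarefreeExp m.support = m := by
  ext i
  have := h i
  simp only [squarefreeExp_apply, Finsupp.mem_support_iff]
  split_ifs <;> omega

theorem prod_X_eq_monomial (W : Finset (Fin n)) :
    ∏ i ∈ W, (X i : MvPolynomial (Fin n) k) = monomial (squarefreeExp W) 1 := by
  rw [squarefreeExp, monomial_sum_one]
  rfl

theorem edgeIdeal_eq_span_monomial : edgeIdeal k H =
    Ideal.span ((fun s => monomial s (1 : k)) '' {s | ∃ E : Finset (Fin n),
      (E : Set (Fin n)) ∈ H.edgeSet ∧ s = squarefreeExp E}) := by
  rw [edgeIdeal]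
  congr 1
  ext f
  constructor
  · rintro ⟨E, hE, rfl⟩
    exact ⟨_, ⟨E, hE, rfl⟩, (prod_X_eq_monomial E).symm⟩
  · rintro ⟨_, ⟨E, hE, rfl⟩, rfl⟩
    exact ⟨E, hE, (prod_X_eq_monomial E).symm⟩

theorem mem_edgeIdeal {f : MvPolynomial (Fin n) k} : f ∈ edgeIdeal k H ↔
    ∀ m ∈ f.support, ∃ E : Finset (Fin n), (E : Set (Fin n)) ∈ H.edgeSet ∧ E ⊆ m.support := by
  rw [edgeIdeal_eq_span_monomial, mem_ideal_span_monomial_image]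
  refine forall₂_congr fun m _ => ?_
  constructor
  · rintro ⟨_, ⟨E, hE, rfl⟩, h⟩
    exact ⟨E, hE, squarefreeExp_le_iff.1 h⟩
  · rintro ⟨E, hE, h⟩
    exact ⟨_, ⟨E, hE, rfl⟩, squarefreeExp_le_iff.2 h⟩

theorem mem_edgeIdealPlusSquares {f : MvPolynomial (Fin n) k} : f ∈ edgeIdealPlusSquares k H ↔
    ∀ m ∈ f.support, (∃ E : Finset (Fin n), (E : Set (Fin n)) ∈ H.edgeSet ∧ E ⊆ m.support) ∨
      ∃ i, 2 ≤ m i := by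
  have hsq : (Set.range fun i : Fin n => (X i : MvPolynomial (Fin n) k) ^ 2) =
      (fun s => monomial s (1 : k)) '' Set.range fun i : Fin n => Finsupp.single i 2 := by
    rw [← Set.range_comp]
    congr 1
    ext1 i
    exact X_pow_eq_monomial
  rw [edgeIdealPlusSquares, edgeIdeal_eq_span_monomial, hsq, ← Ideal.span_union,
    ← Set.image_union, mem_ideal_span_monomial_image]
  refine forall₂_congr fun m _ => ?_
  constructor
  · rintro ⟨_, ⟨E, hE, rfl⟩ | ⟨i, rfl⟩, h⟩
    · exact Or.inl ⟨E, hE, squarefreeExp_le_iff.1 h⟩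
    · exact Or.inr ⟨i, by simpa using h i⟩
  · rintro (⟨E, hE, h⟩ | ⟨i, hi⟩)
    · exact ⟨_, Or.inl ⟨E, hE, rfl⟩, squarefreeExp_le_iff.2 h⟩
    · exact ⟨_, Or.inr ⟨i, rfl⟩, by simpa using hi⟩

theorem polyComp_mem_edgeIdealPlusSquares (j : ℤ) (f : MvPolynomial (Fin n) k)
    (hf : f ∈ edgeIdealPlusSquares k H) : polyComp k n j f ∈ edgeIdealPlusSquares k H := by
  rw [mem_edgeIdealPlusSquares] at *
  intro m hm
  refine hf m ?_
  rw [mem_support_iff, coeff_polyComp] at hm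
  rw [mem_support_iff]
  exact fun h => hm (by rw [h, ite_self])

theorem edgeIdealPlusSquares_le_maxIdeal (hH : H.IsSimple) :
    edgeIdealPlusSquares k H ≤ maxIdeal k n := by
  intro f hf
  rw [mem_maxIdeal]
  by_contra h
  obtain ⟨E, hE, hs⟩ | ⟨i, hi⟩ := mem_edgeIdealPlusSquares.1 hf 0 (mem_support_iff.2 h)
  · have := hH.1 _ hE
    rw [Finset.subset_empty.1 hs] at this
    simp at this
  · simp at hi

/-- A squarefree monomial supported on an independent set does not occur in an element of the
ideal. -/
theorem coeff_squarefreeExp_eq_zero (hV : H.vertexSet = Set.univ) {f : MvPolynomial (Fin n) k}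
    (hf : f ∈ edgeIdealPlusSquares k H) {W : Finset (Fin n)} (hW : H.IsIndependent W) :
    f.coeff (squarefreeExp W) = 0 := by
  by_contra h
  obtain ⟨E, hE, hs⟩ | ⟨i, hi⟩ := mem_edgeIdealPlusSquares.1 hf _ (mem_support_iff.2 h)
  · rw [support_squarefreeExp] at hs
    exact (Hypergraph.isIndependent_iff hV).1 hW E hE hs
  · rw [squarefreeExp_apply] at hi
    split_ifs at hi <;> omega

/-- A monomial outside the ideal has all exponents below 2 and independent support, so it is some
x_W. With the preceding lemma, the x_W with W independent form a k-basis of the quotient. -/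
theorem mem_edgeIdealPlusSquares_of_coeff_eq_zero (hV : H.vertexSet = Set.univ)
    {f : MvPolynomial (Fin n) k}
    (hf : ∀ W, H.IsIndependent W → f.coeff (squarefreeExp W) = 0) :
    f ∈ edgeIdealPlusSquares k H := by
  rw [mem_edgeIdealPlusSquares]
  intro m hm
  by_contra! hc
  have := hf m.support ((Hypergraph.isIndependent_iff hV).2 hc.1)
  rw [squarefreeExp_support hc.2] at this
  exact mem_support_iff.1 hm this

theorem exists_isIndependent_of_quotPiece_ne_bot (hV : H.vertexSet = Set.univ) {d : ℤ}
    (h : quotPiece (edgeIdealPlusSquares k H) d ≠ ⊥) :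
    ∃ W, H.IsIndependent W ∧ (W.card : ℤ) = d := by
  by_contra! hc
  refine h ((Submodule.eq_bot_iff _).2 ?_)
  rintro _ ⟨f, hf, rfl⟩
  refine Ideal.Quotient.eq_zero_iff_mem.2
    (mem_edgeIdealPlusSquares_of_coeff_eq_zero hV fun W hW => ?_)
  by_contra hne
  have := mem_polyPiece.1 hf _ hne
  rw [degree_squarefreeExp] at this
  exact hc W hW this

/-! ### Top Koszul homology and the socle -/

theorem koszulPiece_eq_bot_of_lt {N : Type*} [AddCommGroup N] [Module k N]
    (𝓝 : ℤ → Submodule k N) {p : ℕ} (hp : n < p) (j : ℤ) :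
    koszulPiece (n := n) 𝓝 p j = ⊥ := by
  rw [Submodule.eq_bot_iff]
  intro f hf
  ext1 S
  refine (mem_koszulPiece.1 hf).2 S ?_
  have := S.card_le_univ
  rw [Fintype.card_fin] at this
  omega

/-- The elements of degree `d` which map to the socle of the quotient by an ideal. -/
def soclePreimage (I : Ideal (MvPolynomial (Fin n) k)) (d : ℤ) :
    Submodule k (MvPolynomial (Fin n) k) :=
  polyPiece k n d ⊓ ⨅ i, (I.restrictScalars k).comap (LinearMap.mulLeft k (X i))

theorem mem_soclePreimage {I : Ideal (MvPolynomial (Fin n) k)} {d : ℤ}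
    {f : MvPolynomial (Fin n) k} :
    f ∈ soclePreimage I d ↔ f ∈ polyPiece k n d ∧ ∀ i, X i * f ∈ I := by
  rw [soclePreimage, Submodule.mem_inf, Submodule.mem_iInf]
  rfl

/-- If x_W occurs in f with W independent, then W is maximal: an independent W ∪ {v} would give X v
* f, an element of the ideal, a nonzero coefficient at a basis monomial. -/
theorem mem_edgeIdealPlusSquares_of_mem_soclePreimage (hV : H.vertexSet = Set.univ) {d : ℤ}
    {f : MvPolynomial (Fin n) k} (hf : f ∈ soclePreimage (edgeIdealPlusSquares k H) d)
    (h : ∀ W ∈ H.maximalIndependentSets, (W.card : ℤ) = d → f.coeff (squarefreeExp W) = 0) :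
    f ∈ edgeIdealPlusSquares k H := by
  rw [mem_soclePreimage] at hf
  refine mem_edgeIdealPlusSquares_of_coeff_eq_zero hV fun W hW => ?_
  by_contra hne
  refine hne (h W ((Hypergraph.mem_maximalIndependentSets_iff hV).2 ⟨hW, fun v hv => ?_⟩) ?_)
  · have hc : (X v * f).coeff (squarefreeExp (insert v W)) ≠ 0 := by
      rw [squarefreeExp, Finset.sum_insert hv, coeff_X_mul]
      exact hne
    by_contra! hno
    exact hc (coeff_squarefreeExp_eq_zero hV (hf.2 v) ((Hypergraph.isIndependent_iff hV).2 hno))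
  · have := mem_polyPiece.1 hf.1 _ hne
    rwa [degree_squarefreeExp] at this

theorem X_mul_monomial_mem (hV : H.vertexSet = Set.univ) {W : Finset (Fin n)}
    (hW : W ∈ H.maximalIndependentSets) (c : k) (i : Fin n) :
    X i * monomial (squarefreeExp W) c ∈ edgeIdealPlusSquares k H := by
  rw [mem_edgeIdealPlusSquares, X, monomial_mul, one_mul]
  intro m hm
  rw [Finset.mem_singleton.1 (support_monomial_subset hm)]
  by_cases hi : i ∈ W
  · right
    exact ⟨i, by simp [squarefreeExp_apply, hi]⟩
  · left
    obtain ⟨E, hE, hs⟩ := ((Hypergraph.mem_maximalIndependentSets_iff hV).1 hW).2 i hi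
    refine ⟨E, hE, ?_⟩
    rw [← squarefreeExp_le_iff]
    refine (squarefreeExp_le_iff.2 (hs.trans (support_squarefreeExp _).ge)).trans ?_
    rw [squarefreeExp, Finset.sum_insert hi, squarefreeExp]

/-- In Koszul degree n only the full vertex set carries a coefficient and there are no boundaries,
so the homology is the socle in degree j - n. Its elements are determined by their coefficients at
the x_W with W maximal independent, which are arbitrary. -/
theorem koszulHomDim_socle (hV : H.vertexSet = Set.univ) (j : ℤ) :
    koszulHomDim n (quotPiece (edgeIdealPlusSquares k H)) n j =
      {σ : Finset (Fin n) | σ ∈ H.maximalIndependentSets ∧ (σ.card : ℤ) = j - n}.ncard := by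
  classical
  set I := edgeIdealPlusSquares k H with hI
  set A := {σ : Finset (Fin n) | σ ∈ H.maximalIndependentSets ∧ (σ.card : ℤ) = j - n} with hA
  have hcard : A.ncard = subquotDim (⊤ : Submodule k (A → k)) ⊥ := by
    rw [subquotDim_top_bot, Module.finrank_fintype_fun_eq_card, ← Nat.card_eq_fintype_card]
    rfl
  rw [hcard]
  refine subquotDim_eq_of_correspondence (soclePreimage I (j - n))
    (LinearMap.single k (fun _ : Finset (Fin n) => MvPolynomial (Fin n) k ⧸ I) Finset.univ ∘ₗ
      (Ideal.Quotient.mkₐ k I).toLinearMap)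
    (LinearMap.pi fun W : A => lcoeff k (squarefreeExp W.1)) ?_ ?_ ?_ ?_ ?_
  · intro f hf
    rw [mem_soclePreimage] at hf
    constructor
    · rw [SetLike.mem_coe, mem_koszulPiece]
      refine ⟨fun S hS => ?_, fun S hS => ?_⟩
      · have : S = Finset.univ := by rw [← Finset.card_eq_iff_eq_univ, hS, Fintype.card_fin]
        subst this
        refine ⟨f, hf.1, ?_⟩
        simp
      · have : S ≠ Finset.univ := by rintro rfl; simp at hS
        simp [this]
    · rw [SetLike.mem_coe, LinearMap.mem_ker]
      ext1 S
      rw [koszulDiff_apply]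
      refine Finset.sum_eq_zero fun i _ => ?_
      by_cases h : insert i S = Finset.univ
      · have hz : (X i : MvPolynomial (Fin n) k) • Ideal.Quotient.mk I f = 0 :=
          Ideal.Quotient.eq_zero_iff_mem.2 (hf.2 i)
        simp [h, hz]
      · simp [h]
  · exact fun x _ => trivial
  · rintro z ⟨hz, hz'⟩
    rw [SetLike.mem_coe, mem_koszulPiece] at hz
    obtain ⟨f, hf, hfz⟩ := hz.1 Finset.univ (by simp)
    refine ⟨f, mem_soclePreimage.2 ⟨hf, fun i => ?_⟩, ?_⟩
    -- At the complement of i the differential has the single term ± xᵢ z, so the cycle condition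
    -- says that every variable kills z.
    · have h := congrFun (LinearMap.mem_ker.1 hz') (Finset.univ.erase i)
      rw [koszulDiff_apply, Finset.compl_erase, Finset.compl_univ, insert_empty_eq,
        Finset.sum_singleton, Finset.insert_erase (Finset.mem_univ i), ← hfz] at h
      have h2 := congrArg (koszulSign i (Finset.univ.erase i) • ·) h
      simp only [smul_smul, koszulSign_mul_self, one_smul, Pi.zero_apply, smul_zero] at h2
      exact Ideal.Quotient.eq_zero_iff_mem.1 h2
    · convert Submodule.zero_mem _
      rw [sub_eq_zero]
      ext1 S
      by_cases h : S = Finset.univ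
      · subst h
        rw [← hfz]
        simp
      · rw [hz.2 S (fun hS => h (by rw [← Finset.card_eq_iff_eq_univ, hS, Fintype.card_fin]))]
        simp [h]
  · rintro z -
    refine ⟨∑ W : A, monomial (squarefreeExp W.1) (z W), mem_soclePreimage.2 ⟨?_, fun i => ?_⟩, ?_⟩
    · refine Submodule.sum_mem _ fun W _ => ?_
      have := monomial_mem_polyPiece (squarefreeExp W.1) (z W)
      rwa [degree_squarefreeExp, W.2.2] at this
    · rw [Finset.mul_sum]
      exact Ideal.sum_mem _ fun W _ => X_mul_monomial_mem hV W.2.1 _ i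
    · rw [Submodule.mem_bot, sub_eq_zero]
      ext1 W
      simp only [LinearMap.pi_apply, lcoeff_apply, coeff_sum, coeff_monomial]
      rw [Finset.sum_eq_single W]
      · simp
      · intro W' _ h
        exact if_neg fun e => h (Subtype.ext (squarefreeExp_injective e))
      · exact fun h => absurd (Finset.mem_univ W) h
  · intro f hf
    rw [koszulPiece_eq_bot_of_lt _ (Nat.lt_succ_self n), Submodule.map_bot, Submodule.mem_bot,
      Submodule.mem_bot, LinearMap.comp_apply]
    trans f ∈ I
    · rw [← Ideal.Quotient.eq_zero_iff_mem]
      constructor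
      · intro h
        simpa using congrFun h Finset.univ
      · intro h
        have : (Ideal.Quotient.mkₐ k I).toLinearMap f = 0 := h
        rw [this, map_zero]
    · constructor
      · intro h
        ext1 W
        exact coeff_squarefreeExp_eq_zero hV h
          ((Hypergraph.mem_maximalIndependentSets_iff hV).1 W.2.1).1
      · intro h
        exact mem_edgeIdealPlusSquares_of_mem_soclePreimage hV hf
          fun W hW hc => congrFun h ⟨W, hW, hc⟩

/-! ### Betti numbers and regularity of the quotient -/

theorem betti_eq_koszulHomDim (F : MinimalResolution (n := n)
    (quotPiece (edgeIdealPlusSquares k H))) (p : ℕ) (j : ℤ) :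
    F.betti p j = koszulHomDim n (quotPiece (edgeIdealPlusSquares k H)) p j :=
  F.betti_eq_koszulHomDim (F.exists_aug_eq polyComp_mem_edgeIdealPlusSquares) p j

theorem betti_eq_ncard (hV : H.vertexSet = Set.univ) (F : MinimalResolution (n := n)
    (quotPiece (edgeIdealPlusSquares k H))) (j : ℤ) : F.betti n j =
      {σ : Finset (Fin n) | σ ∈ H.maximalIndependentSets ∧ (σ.card : ℤ) = j - n}.ncard := by
  rw [betti_eq_koszulHomDim, koszulHomDim_socle hV]

theorem betti_ne_zero_iff (hV : H.vertexSet = Set.univ) (F : MinimalResolution (n := n)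
    (quotPiece (edgeIdealPlusSquares k H))) (j : ℤ) : F.betti n j ≠ 0 ↔
      ∃ W ∈ H.maximalIndependentSets, (W.card : ℤ) + n = j := by
  rw [betti_eq_ncard hV, ← Nat.pos_iff_ne_zero, Set.ncard_pos]
  constructor
  · rintro ⟨W, hW, hc⟩
    exact ⟨W, hW, by omega⟩
  · rintro ⟨W, hW, hc⟩
    exact ⟨W, hW, by omega⟩

theorem MinimalResolution.betti_deg_ne_zero {M : Type*} [AddCommGroup M] [Module k M]
    [Module (MvPolynomial (Fin n) k) M] {𝓜 : ℤ → Submodule k M}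
    (F : MinimalResolution (n := n) 𝓜) {i : ℕ} (a : Fin (F.rank i)) :
    F.betti i (F.deg i a) ≠ 0 :=
  Finset.card_ne_zero_of_mem (a := a) (by simp)

theorem MinimalResolution.exists_of_betti_ne_zero {M : Type*} [AddCommGroup M] [Module k M]
    [Module (MvPolynomial (Fin n) k) M] {𝓜 : ℤ → Submodule k M}
    (F : MinimalResolution (n := n) 𝓜) {i : ℕ} {j : ℤ} (h : F.betti i j ≠ 0) :
    ∃ a, F.deg i a = j := by
  obtain ⟨a, ha⟩ := Finset.card_ne_zero.1 h
  exact ⟨a, by simpa using ha⟩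

theorem rank_eq_zero_of_lt (F : MinimalResolution (n := n)
    (quotPiece (edgeIdealPlusSquares k H))) {p : ℕ} (hp : n < p) : F.rank p = 0 := by
  by_contra h
  refine F.betti_deg_ne_zero (i := p) ⟨0, Nat.pos_of_ne_zero h⟩ ?_
  rw [betti_eq_koszulHomDim, koszulHomDim_eq_zero (koszulPiece_eq_bot_of_lt _ hp _)]

theorem totalBetti_eq (hV : H.vertexSet = Set.univ) (F : MinimalResolution (n := n)
    (quotPiece (edgeIdealPlusSquares k H))) :
    F.totalBetti n = H.maximalIndependentSets.ncard := by
  classical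
  set A := H.maximalIndependentSets.toFinset with hA
  -- The basis of Fₙ and the maximal independent sets are both counted by degree, the occurring
  -- degrees being the |W| + n.
  have h1 : F.rank n = ∑ j ∈ A.image fun W => (W.card : ℤ) + n, F.betti n j := by
    conv_lhs => rw [← Fintype.card_fin (F.rank n), ← Finset.card_univ]
    refine Finset.card_eq_sum_card_fiberwise fun a _ => ?_
    obtain ⟨W, hW, hc⟩ := (betti_ne_zero_iff hV F _).1 (F.betti_deg_ne_zero a)
    simp only [Finset.coe_image, Set.mem_image, Finset.mem_coe]
    exact ⟨W, by simpa [hA] using hW, hc⟩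
  have h2 : A.card = ∑ j ∈ A.image fun W => (W.card : ℤ) + n,
      (A.filter fun W => (W.card : ℤ) + n = j).card :=
    Finset.card_eq_sum_card_fiberwise fun W hW => Finset.mem_coe.2 (Finset.mem_image_of_mem _ hW)
  rw [MinimalResolution.totalBetti, h1, Set.ncard_eq_toFinset_card', ← hA, h2]
  refine Finset.sum_congr rfl fun j _ => ?_
  rw [betti_eq_ncard hV, ← Set.ncard_coe_finset]
  congr 1
  ext W
  simp [hA, eq_sub_iff_add_eq]

/-- A nonzero β_{i,j} forces a nonzero chain, hence a nonzero degree j - i part of the quotient,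
hence an independent set of size j - i. Equality comes from a maximal independent set of largest
size at i = n. -/
theorem hasRegularity (hV : H.vertexSet = Set.univ) (hH : H.IsSimple)
    (F : MinimalResolution (n := n) (quotPiece (edgeIdealPlusSquares k H))) :
    F.HasRegularity (H.independenceNumber : ℤ) := by
  constructor
  · obtain ⟨W, hW, hc⟩ := Hypergraph.exists_maximal_card_eq hV hH
    refine ⟨n, W.card + n, (betti_ne_zero_iff hV F _).2 ⟨W, hW, rfl⟩, ?_⟩
    rw [hc]
    ring
  · rintro _ ⟨i, j, hb, rfl⟩
    obtain ⟨W, hW, hc⟩ : ∃ W, H.IsIndependent W ∧ (W.card : ℤ) = j - i := by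
      refine exists_isIndependent_of_quotPiece_ne_bot (k := k) hV fun h => hb ?_
      rw [betti_eq_koszulHomDim, koszulHomDim_eq_zero]
      rw [Submodule.eq_bot_iff]
      intro f hf
      rw [mem_koszulPiece, h] at hf
      ext1 S
      by_cases hS : S.card = i
      · exact (Submodule.mem_bot k).1 (hf.1 S hS)
      · exact hf.2 S hS
    rw [← hc]
    exact_mod_cast Hypergraph.card_le_independenceNumber hW

/-! ### Ideals generated by variables -/

variable (k) in
/-- The ideal generated by the variables indexed by `T`. -/
def varIdeal (T : Finset (Fin n)) : Ideal (MvPolynomial (Fin n) k) := Ideal.span (X '' (T : Set _))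

theorem mem_varIdeal {T : Finset (Fin n)} {f : MvPolynomial (Fin n) k} :
    f ∈ varIdeal k T ↔ ∀ m ∈ f.support, ∃ i ∈ T, m i ≠ 0 :=
  mem_ideal_span_X_image

/-- Serves primality: the target of the map that kills the variables in T is a domain. -/
theorem varIdeal_eq_ker (T : Finset (Fin n)) : varIdeal k T =
    RingHom.ker (aeval fun i => if i ∈ T then 0 else X i :
      MvPolynomial (Fin n) k →ₐ[k] MvPolynomial (Fin n) k) := by
  set φ := (aeval fun i => if i ∈ T then 0 else X i :
      MvPolynomial (Fin n) k →ₐ[k] MvPolynomial (Fin n) k) with hφ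
  have hX : ∀ i, φ (X i) = if i ∈ T then 0 else X i := fun i => aeval_X _ i
  apply le_antisymm
  · rw [varIdeal, Ideal.span_le]
    rintro _ ⟨i, hi, rfl⟩
    rw [SetLike.mem_coe, RingHom.mem_ker, hX, if_pos (Finset.mem_coe.1 hi)]
  -- The map φ is the identity modulo the ideal, as one sees on the variables; so φ f = 0 puts f in
  -- the ideal.
  · have key : ∀ f, f - φ f ∈ varIdeal k T := by
      intro f
      rw [← Ideal.Quotient.eq]
      change (Ideal.Quotient.mkₐ k (varIdeal k T)) f = ((Ideal.Quotient.mkₐ k _).comp φ) f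
      congr 1
      refine algHom_ext fun i => ?_
      rw [AlgHom.comp_apply, hX]
      split_ifs with h
      · rw [map_zero]
        exact Ideal.Quotient.eq_zero_iff_mem.2 (Ideal.subset_span ⟨i, h, rfl⟩)
      · rfl
    intro f hf
    have := key f
    rwa [RingHom.mem_ker.1 hf, sub_zero] at this

instance isPrime_varIdeal (T : Finset (Fin n)) : (varIdeal k T).IsPrime := by
  rw [varIdeal_eq_ker]
  exact RingHom.ker_isPrime _

theorem monomial_mem_varIdeal_iff {T W : Finset (Fin n)} :
    monomial (squarefreeExp W) (1 : k) ∈ varIdeal k T ↔ ∃ i ∈ T, i ∈ W := by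
  classical
  rw [mem_varIdeal, support_monomial, if_neg one_ne_zero]
  simp [squarefreeExp_apply]

theorem X_mem_varIdeal_iff {T : Finset (Fin n)} {i : Fin n} :
    (X i : MvPolynomial (Fin n) k) ∈ varIdeal k T ↔ i ∈ T := by
  rw [mem_varIdeal, support_X]
  simp [Finsupp.single_apply]

theorem varIdeal_le_iff {T T' : Finset (Fin n)} : varIdeal k T ≤ varIdeal k T' ↔ T ⊆ T' := by
  rw [varIdeal, Ideal.span_le]
  constructor
  · exact fun h i hi => X_mem_varIdeal_iff.1 (h ⟨i, hi, rfl⟩)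
  · rintro h _ ⟨i, hi, rfl⟩
    exact X_mem_varIdeal_iff.2 (h hi)

/-- The upper bound is Krull's height theorem; the lower bound adds one variable at a time to get a
strict chain of primes. -/
theorem height_varIdeal (T : Finset (Fin n)) : (varIdeal k T).height = T.card := by
  classical
  apply le_antisymm
  · have h : varIdeal k T = Ideal.span
        ((T.image X : Finset (MvPolynomial (Fin n) k)) : Set (MvPolynomial (Fin n) k)) := by
      rw [Finset.coe_image]
      rfl
    refine (Ideal.height_le_card_of_mem_minimalPrimes_span_finset (s := T.image X) ?_).trans
      (by exact_mod_cast Finset.card_image_le)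
    rw [← h, Ideal.minimalPrimes_eq_subsingleton_self]
    rfl
  · induction T using Finset.induction_on with
    | empty => simp
    | insert i T hi ih =>
      have hlt : varIdeal k T < varIdeal k (insert i T) :=
        ⟨varIdeal_le_iff.2 (Finset.subset_insert i T),
          fun h => hi (varIdeal_le_iff.1 h (Finset.mem_insert_self i T))⟩
      rw [Finset.card_insert_of_notMem hi, Nat.cast_add, Nat.cast_one]
      exact (add_le_add_left ih 1).trans (Ideal.height_add_one_le_of_lt_of_isPrime hlt)

/-! ### Associated primes of edge ideals -/

/-- The edge ideal is the intersection of the primes generated by the complements of the maximal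
independent sets. -/
theorem mem_edgeIdeal_iff_forall_varIdeal (hV : H.vertexSet = Set.univ)
    {f : MvPolynomial (Fin n) k} :
    f ∈ edgeIdeal k H ↔ ∀ W ∈ H.maximalIndependentSets, f ∈ varIdeal k Wᶜ := by
  rw [mem_edgeIdeal]
  constructor
  · intro h W hW
    rw [mem_varIdeal]
    intro m hm
    obtain ⟨E, hE, hs⟩ := h m hm
    have hind := ((Hypergraph.mem_maximalIndependentSets_iff hV).1 hW).1
    obtain ⟨i, hiE, hiW⟩ := Finset.not_subset.1 ((Hypergraph.isIndependent_iff hV).1 hind E hE)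
    exact ⟨i, Finset.mem_compl.2 hiW, Finsupp.mem_support_iff.1 (hs hiE)⟩
  · intro h m hm
    by_contra! hc
    obtain ⟨W, hW, hmW⟩ := Hypergraph.exists_maximal_of_isIndependent hV
      ((Hypergraph.isIndependent_iff hV).2 hc)
    obtain ⟨i, hi, him⟩ := mem_varIdeal.1 (h W hW) m hm
    exact Finset.mem_compl.1 hi (hmW (Finsupp.mem_support_iff.2 him))

theorem eq_of_subset_of_mem_maximalIndependentSets (hV : H.vertexSet = Set.univ)
    {W W' : Finset (Fin n)} (hW : W ∈ H.maximalIndependentSets)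
    (hW' : W' ∈ H.maximalIndependentSets) (h : W ⊆ W') : W = W' := by
  rw [← Hypergraph.facets_independenceComplex hV] at hW hW'
  exact Maximal.eq_of_le hW hW'.prop h

theorem mem_associatedPrimes_quotient_iff {R : Type*} [CommRing R] [IsNoetherianRing R]
    {J P : Ideal R} : P ∈ associatedPrimes R (R ⧸ J) ↔
      P.IsPrime ∧ ∃ f, ∀ r, r ∈ P ↔ r * f ∈ J := by
  rw [AssociatedPrimes.mem_iff, isAssociatedPrime_iff]
  refine and_congr_right fun _ => ?_
  have h : ∀ r f, r ∈ Submodule.colon (⊥ : Submodule R (R ⧸ J)) {Ideal.Quotient.mk J f} ↔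
      r * f ∈ J := by
    intro r f
    rw [Submodule.mem_colon_singleton, Submodule.mem_bot, ← Ideal.Quotient.eq_zero_iff_mem]
    rfl
  constructor
  · rintro ⟨x, rfl⟩
    obtain ⟨f, rfl⟩ := Ideal.Quotient.mk_surjective x
    exact ⟨f, fun r => h r f⟩
  · rintro ⟨f, hf⟩
    exact ⟨Ideal.Quotient.mk J f, Ideal.ext fun r => (hf r).trans (h r f).symm⟩

/-- Let P_W be generated by the variables outside W. If P = (J : f), then P contains the
intersection of the P_W not containing f, hence one of them, and lies in each of them. Conversely
x_W avoids P_W but lies in P_{W'} for every other maximal W', so (J : x_W) = P_W. -/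
theorem mem_associatedPrimes_edgeIdeal_iff (hV : H.vertexSet = Set.univ)
    {P : Ideal (MvPolynomial (Fin n) k)} :
    P ∈ associatedPrimes (MvPolynomial (Fin n) k) (MvPolynomial (Fin n) k ⧸ edgeIdeal k H) ↔
      ∃ W ∈ H.maximalIndependentSets, P = varIdeal k Wᶜ := by
  classical
  rw [mem_associatedPrimes_quotient_iff]
  constructor
  · rintro ⟨hP, f, hf⟩
    let s := Finset.univ.filter fun W => W ∈ H.maximalIndependentSets ∧ f ∉ varIdeal k Wᶜ
    have hle : s.inf (fun W => varIdeal k Wᶜ) ≤ P := by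
      intro r hr
      rw [hf, mem_edgeIdeal_iff_forall_varIdeal hV]
      intro W hW
      by_cases hfW : f ∈ varIdeal k Wᶜ
      · exact Ideal.mul_mem_left _ _ hfW
      · have hWs : W ∈ s := by simp [s, hW, hfW]
        exact Ideal.mul_mem_right _ _ ((Finset.inf_le (f := fun W => varIdeal k Wᶜ) hWs) hr)
    obtain ⟨W, hWs, hWP⟩ := hP.inf_le'.1 hle
    obtain ⟨hW, hfW⟩ : W ∈ H.maximalIndependentSets ∧ f ∉ varIdeal k Wᶜ := by simpa [s] using hWs
    refine ⟨W, hW, le_antisymm (fun r hr => ?_) hWP⟩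
    exact ((isPrime_varIdeal Wᶜ).mem_or_mem
      ((mem_edgeIdeal_iff_forall_varIdeal hV).1 ((hf r).1 hr) W hW)).resolve_right hfW
  · rintro ⟨W, hW, rfl⟩
    refine ⟨inferInstance, monomial (squarefreeExp W) 1, fun r => ?_⟩
    rw [mem_edgeIdeal_iff_forall_varIdeal hV]
    constructor
    · intro hr W' hW'
      by_cases h : W = W'
      · subst h
        exact Ideal.mul_mem_right _ _ hr
      · refine Ideal.mul_mem_left _ _ (monomial_mem_varIdeal_iff.2 ?_)
        obtain ⟨i, hi, hi'⟩ := Finset.not_subset.1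
          (mt (eq_of_subset_of_mem_maximalIndependentSets hV hW hW') h)
        exact ⟨i, Finset.mem_compl.2 hi', hi⟩
    · intro h
      refine ((isPrime_varIdeal Wᶜ).mem_or_mem (h W hW)).resolve_right ?_
      rw [monomial_mem_varIdeal_iff]
      rintro ⟨i, hi, hi'⟩
      exact Finset.mem_compl.1 hi hi'

theorem isPure_iff_isUnmixed (hV : H.vertexSet = Set.univ) :
    SimplicialFamily.IsPure H.independenceComplex ↔ IsUnmixed (edgeIdeal k H) := by
  have hcard : ∀ W W' : Finset (Fin n),
      (varIdeal k Wᶜ).height = (varIdeal k W'ᶜ).height ↔ W.card = W'.card := by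
    intro W W'
    rw [height_varIdeal, height_varIdeal, Nat.cast_inj, Finset.card_compl, Finset.card_compl]
    have := W.card_le_univ
    have := W'.card_le_univ
    omega
  unfold SimplicialFamily.IsPure IsUnmixed
  simp only [Hypergraph.facets_independenceComplex hV, mem_associatedPrimes_edgeIdeal_iff hV]
  constructor
  · rintro h _ ⟨W, hW, rfl⟩ _ ⟨W', hW', rfl⟩
    exact (hcard W W').2 (h W hW W' hW')
  · intro h W hW W' hW'
    exact (hcard W W').1 (h _ ⟨W, hW, rfl⟩ _ ⟨W', hW', rfl⟩)

/-! ### Levelness -/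

theorem finite_quotient_edgeIdealPlusSquares (hV : H.vertexSet = Set.univ) :
    Module.Finite k (MvPolynomial (Fin n) k ⧸ edgeIdealPlusSquares k H) := by
  classical
  let ψ : (Finset (Fin n) → k) →ₗ[k] MvPolynomial (Fin n) k :=
    ∑ W, monomial (squarefreeExp W) ∘ₗ LinearMap.proj W
  refine Module.Finite.of_surjective
    ((Ideal.Quotient.mkₐ k (edgeIdealPlusSquares k H)).toLinearMap ∘ₗ ψ) fun y => ?_
  obtain ⟨f, rfl⟩ := Ideal.Quotient.mk_surjective y
  refine ⟨fun W => f.coeff (squarefreeExp W), ?_⟩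
  refine Ideal.Quotient.eq.2 (mem_edgeIdealPlusSquares_of_coeff_eq_zero hV fun W _ => ?_)
  have hψ : (ψ fun W => f.coeff (squarefreeExp W)) =
      ∑ W, monomial (squarefreeExp W) (f.coeff (squarefreeExp W)) := by
    simp [ψ]
  rw [coeff_sub, hψ, coeff_sum, Finset.sum_eq_single W]
  · simp
  · intro W' _ h
    rw [coeff_monomial, if_neg fun e => h (squarefreeExp_injective e)]
  · exact fun h => absurd (Finset.mem_univ W) h

/-- The quotient is a nonzero finite-dimensional algebra, so its Krull dimension is zero and the
empty regular sequence is enough. -/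
theorem isCohenMacaulay (hV : H.vertexSet = Set.univ) (hH : H.IsSimple) :
    IsCohenMacaulay (edgeIdealPlusSquares k H) := by
  have hne : edgeIdealPlusSquares k H ≠ ⊤ := by
    intro h
    have := edgeIdealPlusSquares_le_maxIdeal (k := k) hH ((Ideal.eq_top_iff_one _).1 h)
    rw [mem_maxIdeal] at this
    simp at this
  have : Nontrivial (MvPolynomial (Fin n) k ⧸ edgeIdealPlusSquares k H) :=
    Ideal.Quotient.nontrivial_iff.2 hne
  have := finite_quotient_edgeIdealPlusSquares (k := k) hV
  have : IsArtinianRing (MvPolynomial (Fin n) k ⧸ edgeIdealPlusSquares k H) :=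
    IsArtinianRing.of_finite k _
  refine ⟨[], by simp, RingTheory.Sequence.IsRegular.nil _ _, ?_⟩
  rw [ringKrullDimZero_iff_ringKrullDim_eq_zero.1 inferInstance]
  rfl

/-- The last nonzero module is Fₙ: its rank is positive because a maximal independent set exists,
and all later ranks vanish. Its generator degrees are the |W| + n. -/
theorem isLevel_iff_isPure (hV : H.vertexSet = Set.univ) (hH : H.IsSimple) :
    IsLevel (edgeIdealPlusSquares k H) ↔ SimplicialFamily.IsPure H.independenceComplex := by
  unfold SimplicialFamily.IsPure
  rw [Hypergraph.facets_independenceComplex hV]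
  have hrank : ∀ F : MinimalResolution (n := n) (quotPiece (edgeIdealPlusSquares k H)),
      F.rank n ≠ 0 := by
    intro F h
    obtain ⟨W, hW, -⟩ := Hypergraph.exists_maximal_card_eq hV hH
    obtain ⟨a, -⟩ := F.exists_of_betti_ne_zero ((betti_ne_zero_iff hV F _).2 ⟨W, hW, rfl⟩)
    rw [h] at a
    exact a.elim0
  constructor
  · rintro ⟨-, F, p, hp, hlast, s, hs⟩ W hW W' hW'
    have hpn : p = n := by
      rcases lt_trichotomy p n with h | h | h
      · exact absurd (hlast n h) (hrank F)
      · exact h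
      · exact absurd (rank_eq_zero_of_lt F h) hp
    subst hpn
    obtain ⟨a, ha⟩ := F.exists_of_betti_ne_zero ((betti_ne_zero_iff hV F _).2 ⟨W, hW, rfl⟩)
    obtain ⟨b, hb⟩ := F.exists_of_betti_ne_zero ((betti_ne_zero_iff hV F _).2 ⟨W', hW', rfl⟩)
    have := hs a
    have := hs b
    omega
  · intro h
    obtain ⟨F⟩ := nonempty_minimalResolution (I := edgeIdealPlusSquares k H)
      polyComp_mem_edgeIdealPlusSquares (edgeIdealPlusSquares_le_maxIdeal hH)
    obtain ⟨W, hW, -⟩ := Hypergraph.exists_maximal_card_eq hV hH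
    refine ⟨isCohenMacaulay hV hH, F, n, hrank F, fun q hq => rank_eq_zero_of_lt F hq,
      W.card + n, fun a => ?_⟩
    obtain ⟨W', hW', hc⟩ := (betti_ne_zero_iff hV F _).1 (F.betti_deg_ne_zero a)
    rw [← hc, h W' hW' W hW]

end GradedRes

end

theorem corollary4p5 {k : Type*} [Field k] {n : ℕ} (H : Hypergraph (Fin n))
    (hV : H.vertexSet = Set.univ) (hH : H.IsSimple) :
    -- a minimal graded free resolution of `R ⧸ I` exists,
    Nonempty (GradedRes.MinimalResolution (n := n)
      (GradedRes.quotPiece (GradedRes.edgeIdealPlusSquares k H))) ∧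
    -- and the Betti numbers and the regularity read off from any of them are as follows
    (∀ F : GradedRes.MinimalResolution (n := n)
        (GradedRes.quotPiece (GradedRes.edgeIdealPlusSquares k H)),
      (∀ j : ℤ, F.betti n j =
        {σ : Finset (Fin n) | σ ∈ H.maximalIndependentSets ∧ (σ.card : ℤ) = j - n}.ncard) ∧
      F.totalBetti n = H.maximalIndependentSets.ncard ∧
      F.totalBetti n = (SimplicialFamily.facets H.independenceComplex).ncard ∧
      F.HasRegularity (H.independenceNumber : ℤ)) ∧
    (GradedRes.IsLevel (GradedRes.edgeIdealPlusSquares k H) ↔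
      SimplicialFamily.IsPure H.independenceComplex) ∧
    (SimplicialFamily.IsPure H.independenceComplex ↔
      GradedRes.IsUnmixed (GradedRes.edgeIdeal k H)) := by
  refine ⟨GradedRes.nonempty_minimalResolution GradedRes.polyComp_mem_edgeIdealPlusSquares
    (GradedRes.edgeIdealPlusSquares_le_maxIdeal hH), fun F => ⟨GradedRes.betti_eq_ncard hV F,
      GradedRes.totalBetti_eq hV F, ?_, GradedRes.hasRegularity hV hH F⟩,
    GradedRes.isLevel_iff_isPure hV hH, GradedRes.isPure_iff_isUnmixed hV⟩
  rw [Hypergraph.facets_independenceComplex hV]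
  exact GradedRes.totalBetti_eq hV F
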